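/- Let $0\le p\le n$ be integers and let $(e_1,\dots,e_n)$ be the standard basis of $\mathbb{C}^n$. For $1\le k\le n$ and a vector $v$ uniformly distributed on the unit sphere of $\operatorname{span}(e_k,\dots,e_n)\subset\mathbb{C}^n$, let $r^{(k)}\in U(n)$ be the reflection ($r^{(k)}-\mathrm{Id}$ has rank $0$ or $1$) with $r^{(k)}e_j=e_j$ for $j<k$ and $r^{(k)}e_k=v$, explicitly $$r^{(k)}=\mathrm{Id}-\frac{(v-e_k)(v-e_k)^*}{1-\overline{v_k}}\qquad(r^{(k)}=\mathrm{Id}\text{ if }v=e_k),$$ and let $\nu^{(k)}$ be its law. The Haar measure on $U(n)$ conditioned to have $p$ eigenvalues equal to $1$ is, by definition, $\nu^{(1)}\times\dots\times\nu^{(n-p)}$, the law of the product $u=r^{(1)}r^{(2)}\cdots r^{(n-p)}$ of independent reflections $r^{(k)}\sim\nu^{(k)}$ (for $p=0$ this is the Haar measure on $U(n)$; for $p=n$ the empty product is $\mathrm{Id}$). Let $$Z_U^{(p)}=\frac{d^p}{dx^p}\Big|_{x=1}\det(x\,\mathrm{Id}-u).$$ Then, under this measure, $$\frac{Z_U^{(p)}}{p!}\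 \stackrel{\text{law}}{=}\ \prod_{\ell=1}^{n-p}(1-X_\ell),$$ where $X_1,\dots,X_{n-p}$ are independent complex random variables and, for each $\ell$, the law of $X_\ell$ is the $|1-X|^{2p}$-sampling of the law of $X=e^{i\theta}\sqrt{B_{1,\ell-1}}$, with $\theta$ uniform on $(-\pi,\pi)$ and $B_{1,\ell-1}$ an independent beta variable with parameters $(1,\ell-1)$ (and $B_{1,0}=1$). Here, for a measurable $h\ge 0$ with $0<\mathbb{E}_\mu(h)<\infty$, the $h$-sampling of a probability measure $\mu$ is the probability measure $\mu'$ with $\mathbb{E}_{\mu'}(f)=\mathbb{E}_\mu(fh)/\mathbb{E}_\mu(h)$ for all bounded measurable $f$. -/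

import Mathlib

open MeasureTheory ProbabilityTheory
open scoped ENNReal ComplexConjugate

noncomputable section

namespace CondHaar

/-! ### The unitary group and reflections -/

/-- The unitary group `U(n)` carries its Borel `σ`-algebra. -/
instance instMeasurableSpaceUnitaryGroup (n : ℕ) :
    MeasurableSpace (Matrix.unitaryGroup (Fin n) ℂ) := borel _

instance instBorelSpaceUnitaryGroup (n : ℕ) :
    BorelSpace (Matrix.unitaryGroup (Fin n) ℂ) := ⟨rfl⟩

/-- The unit sphere of `{x ∈ ℂⁿ | x j = 0 for all j < k}`, whose points are written with their
coordinates of index `j ≥ k` only. Indices start at `0`. -/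
abbrev CSphere {n : ℕ} (k : Fin n) : Type :=
  Metric.sphere (0 : EuclideanSpace ℂ (Set.Ici k)) 1

/-- A point of `CSphere k`, seen as a vector of `ℂⁿ` (the coordinates `j < k` are `0`). -/
def extend {n : ℕ} {k : Fin n} (x : CSphere k) : Fin n → ℂ :=
  fun j => if h : k ≤ j then x.1 ⟨j, h⟩ else 0

/-- The matrix `1 - (1 - conj v_k)⁻¹ (v - e_k)(v - e_k)^*`. For a unit vector `v ≠ e_k`
it is the unique unitary matrix `r` with `rank (r - 1) ≤ 1` and `r e_k = v`: its column `k` is `v`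
and its column `j ≠ k` is `e_j - (v - e_k) * conj v_j / (1 - conj v_k)`. If `v = e_k`
it is the identity. -/
def reflectionMatrix {n : ℕ} (k : Fin n) (v : Fin n → ℂ) : Matrix (Fin n) (Fin n) ℂ :=
  1 - (1 - conj (v k))⁻¹ • Matrix.vecMulVec (v - Pi.single k 1) (star (v - Pi.single k 1))

lemma extend_dotProduct {n : ℕ} {k : Fin n} (x : CSphere k) :
    star (extend x) ⬝ᵥ extend x = 1 := by
  have h1 : ‖x.1‖ ^ 2 = 1 := by
    have h : ‖x.1‖ = 1 := by simp
    rw [h, one_pow]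
  rw [EuclideanSpace.norm_sq_eq] at h1
  have h2 : ∑ j : Fin n, ‖extend x j‖ ^ 2 = 1 := by
    rw [← h1, ← Finset.sum_subset (Finset.subset_univ (Finset.Ici k)) (by
      intro j _ hj
      have : ¬ k ≤ j := by simpa using hj
      simp [extend, this])]
    rw [Finset.sum_subtype (Finset.Ici k) (p := fun j => j ∈ Set.Ici k) (by simp)
      (fun j => ‖extend x j‖ ^ 2)]
    refine Finset.sum_congr rfl fun j _ => ?_
    have : k ≤ j.1 := j.2
    simp [extend, this]
  have h3 : star (extend x) ⬝ᵥ extend x = ((∑ j : Fin n, ‖extend x j‖ ^ 2 : ℝ) : ℂ) := by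
    simp only [dotProduct, Pi.star_apply, RCLike.star_def, Complex.conj_mul']
    push_cast
    rfl
  rw [h3, h2, Complex.ofReal_one]

lemma reflectionMatrix_mem {n : ℕ} (k : Fin n) (v : Fin n → ℂ) (hv : star v ⬝ᵥ v = 1) :
    reflectionMatrix k v ∈ Matrix.unitaryGroup (Fin n) ℂ := by
  rw [Matrix.mem_unitaryGroup_iff, reflectionMatrix]
  set w := v - Pi.single k 1 with hw
  set a := conj (v k) with ha
  have hva : v k = conj a := by simp [ha]
  have hww : star w ⬝ᵥ w = (1 - a) + conj (1 - a) := by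
    have e1 : star (Pi.single k (1 : ℂ) : Fin n → ℂ) = Pi.single k 1 := by
      rw [← Pi.single_star, star_one]
    rw [hw, star_sub, sub_dotProduct, dotProduct_sub, dotProduct_sub, hv, e1]
    simp [hva]
    ring
  have hs : star (1 - (1 - a)⁻¹ • Matrix.vecMulVec w (star w)) =
      1 - (conj (1 - a))⁻¹ • Matrix.vecMulVec w (star w) := by
    rw [star_sub, star_one, star_smul, Matrix.star_eq_conjTranspose,
      Matrix.conjTranspose_vecMulVec, star_star]
    simp
  rw [hs, sub_mul, mul_sub, mul_sub, one_mul, one_mul, mul_one, smul_mul_smul_comm,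
    Matrix.vecMulVec_mul_vecMulVec, hww]
  have key : (1 - a)⁻¹ + (conj (1 - a))⁻¹ =
      (1 - a)⁻¹ * (conj (1 - a))⁻¹ * ((1 - a) + conj (1 - a)) := by
    by_cases h : 1 - a = 0
    · simp [h]
    · have h' : conj (1 - a) ≠ 0 := (map_ne_zero _).2 h
      field_simp
      ring
  ext i j
  simp only [Matrix.sub_apply, Matrix.smul_apply, Matrix.vecMulVec_apply, smul_eq_mul,
    Pi.smul_apply, Pi.star_apply]
  linear_combination (-(w i * star (w j))) * key

/-- The reflection `r ∈ U(n)` with `r e_j = e_j` for `j < k` and `r e_k = x`. -/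
def reflection {n : ℕ} {k : Fin n} (x : CSphere k) : Matrix.unitaryGroup (Fin n) ℂ :=
  ⟨reflectionMatrix k (extend x), reflectionMatrix_mem k _ (extend_dotProduct x)⟩

/-- The uniform probability measure on the complex sphere: the normalized surface measure. -/
def uniformSphere {n : ℕ} (k : Fin n) : Measure (CSphere k) :=
  ((volume : Measure (EuclideanSpace ℂ (Set.Ici k))).toSphere Set.univ)⁻¹ •
    (volume : Measure (EuclideanSpace ℂ (Set.Ici k))).toSphere

/-- The law of a random reflection `r` with `r e_j = e_j` for `j < k` and `r e_k` uniform on the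
unit sphere of the span of the `e_j`, `j ≥ k`. -/
def reflectionLaw {n : ℕ} (k : Fin n) : Measure (Matrix.unitaryGroup (Fin n) ℂ) :=
  (uniformSphere k).map reflection

/-- The Haar measure on `U(n)` conditioned to have `p` eigenvalues equal to `1`: the law of
`r_0 r_1 ⋯ r_{n-p-1}`, the `r_k` being independent with laws `reflectionLaw k`. -/
def condHaar (n p : ℕ) : Measure (Matrix.unitaryGroup (Fin n) ℂ) :=
  (Measure.pi fun k : Fin (n - p) => reflectionLaw (k.castLE (Nat.sub_le n p))).map
    fun r => (List.ofFn r).prod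

/-- The `p`-th derivative at `1` of the characteristic polynomial `x ↦ det (x - u)`. -/
def charpolyDeriv {n : ℕ} (p : ℕ) (u : Matrix.unitaryGroup (Fin n) ℂ) : ℂ :=
  (Polynomial.derivative^[p] (u : Matrix (Fin n) (Fin n) ℂ).charpoly).eval 1

/-! ### The factors -/

/-- The law of a beta variable `B_{1,b}`; for `b = 0` it is the constant `1`. -/
def betaLaw (b : ℕ) : Measure ℝ :=
  if b = 0 then Measure.dirac 1 else betaMeasure 1 b

/-- The law of `e^{iθ} √B_{1,b}`, with `θ` uniform on `(-π, π)` and independent of `B_{1,b}`. -/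
def diskLaw (b : ℕ) : Measure ℂ :=
  ((volume[|Set.Ioo (-Real.pi) Real.pi]).prod (betaLaw b)).map
    fun q => Complex.exp (q.1 * Complex.I) * (Real.sqrt q.2 : ℂ)

/-- The `h`-sampling of `μ`: the measure with `E'[f] = E[f h] / E[h]`. -/
def sampling {α : Type*} [MeasurableSpace α] (h : α → ℝ) (μ : Measure α) : Measure α :=
  (∫⁻ x, ENNReal.ofReal (h x) ∂μ)⁻¹ • μ.withDensity fun x => ENNReal.ofReal (h x)

/-- The `|1 - X|^{2p}`-sampling of `X = e^{iθ} √B_{1,b}`. -/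
def factorLaw (p b : ℕ) : Measure ℂ :=
  sampling (fun x => ‖1 - x‖ ^ (2 * p)) (diskLaw b)

end CondHaar

end

/-!
# The characteristic polynomial at `1` under conditioned Haar measure

Write `Z_d(u)` for the coefficient of `(x - 1) ^ d` in `det (x - u)`, which is the coefficient of
`X ^ d` in the characteristic polynomial of `u - 1` (`charpolyDeriv_div_factorial`). The product
`u = r_0 ⋯ r_{n-p-1}` is built from the right, one reflection at a time.

*Algebra.* Let `u` be unitary with `1` as an eigenvalue of multiplicity at least `d + 1`, and let
`r = 1 - (1 - conj v_j)⁻¹ w w^*` with `w = v - e_j`. The matrix determinant lemma gives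
`Z_d(r u) = Z_{d+1}(u) (1 - conj v_j)⁻¹ ‖P w‖²`, where `P` is the orthogonal projection on
`ker (u - 1)` (`charpoly_reflectionMatrix_mul`). When `u` is a product of reflections of index
`> j`, its fixed space contains `e_0, …, e_j`, and `Z_{d+1}(u) ≠ 0` forces it to have dimension
exactly `d + 1`. Decompose the unit vector `v` as `a e_j + c + b`, with `c` in the fixed space and
`b` orthogonal to it. The new factor is `(‖1 - a‖² + ‖c‖²) / (1 - conj a)`, and `v` is uniform on
a sphere, so the law of this factor depends on `u` only through the dimensions `p` of `c` and `q`
of `b`. Hence the factors are independent.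

*The law of one factor.* Replace the sphere by Lebesgue measure on `ℂ^p × ℂ^q × ℂ`, the factor
being extended to a homogeneous function of degree `0`. With `ρ = √(‖a‖² + ‖c‖² + ‖b‖²)`, the
coordinate `z = ρ - conj a` ranges over a half-plane and satisfies
`2 ρ Re z = ‖z‖² + ‖c‖² + ‖b‖²`; the change of variables has density `ρ / Re z`
(`lintegral_rightHalfPlane`). After the scalings `c = ‖z‖ h` and `b = √(1 + ‖h‖²) b'` the factor is
`conj z / ρ'` with `2 ρ' Re z = ‖z‖² + ‖b'‖²`, which is `1 - a' / ρ'` for a point `(b', a')` of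
`ℂ^q × ℂ`, and the Jacobians contribute the weight `‖1 - a' / ρ'‖ ^ (2 p)` times a function of `h`
and `ρ'` alone (`lintegral_ratio_eq`). Since `a' / ρ'` is distributed as `e^{iθ} √B_{1,q}` under
any weight that is a function of `ρ'` (`exists_lintegral_diskLaw`), the factor is distributed as
`1 - X` with `X` of law `factorLaw p q` (`lintegral_uniformSphere_eq`). Constants are never
computed: both sides have total mass one.
-/

noncomputable section

namespace CondHaar

open Matrix Polynomial

/-! ### Rank one perturbations and characteristic polynomials -/

section RankOne

variable {ι : Type*} [Fintype ι] [DecidableEq ι]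

/-- The matrix determinant lemma, with the adjugate in place of the inverse. -/
lemma det_add_vecMulVec {R : Type*} [CommRing R] [IsDomain R] (M : Matrix ι ι R)
    (hM : M.det ≠ 0) (a b : ι → R) :
    (M + vecMulVec a b).det = M.det + b ⬝ᵥ (M.adjugate *ᵥ a) := by
  -- Pass to the fraction field, where `M` is invertible.
  set f : R →+* FractionRing R := algebraMap R (FractionRing R)
  have hf : Function.Injective f := IsFractionRing.injective R (FractionRing R)
  apply hf
  have hu : IsUnit (f.mapMatrix M).det := by
    rw [← RingHom.map_det, isUnit_iff_ne_zero]
    exact fun h => hM (hf (by rw [h, map_zero]))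
  have h1 : f.mapMatrix (M + vecMulVec a b) = f.mapMatrix M +
      replicateCol Unit (f ∘ a) * replicateRow Unit (f ∘ b) := by
    ext i j
    simp [vecMulVec_apply, mul_apply]
  have h2 : (1 + replicateRow Unit (f ∘ b) * (f.mapMatrix M)⁻¹ * replicateCol Unit (f ∘ a)).det =
      1 + (f ∘ b) ⬝ᵥ ((f.mapMatrix M)⁻¹ *ᵥ (f ∘ a)) := by
    rw [det_unique, Matrix.mul_assoc]
    simp only [Matrix.add_apply, one_apply_eq]
    rfl
  have h3 : f (b ⬝ᵥ (M.adjugate *ᵥ a)) =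
      (f ∘ b) ⬝ᵥ ((f.mapMatrix M).adjugate *ᵥ (f ∘ a)) := by
    rw [← RingHom.map_adjugate]
    simp [dotProduct, mulVec]
  rw [RingHom.map_det, h1, det_add_replicateCol_mul_replicateRow hu, h2, map_add, RingHom.map_det,
    h3, inv_def, smul_mulVec, dotProduct_smul, mul_add, mul_one, smul_eq_mul, ← mul_assoc,
    Ring.mul_inverse_cancel _ hu, one_mul]

variable (N : Matrix ι ι ℂ)

lemma charmatrix_mulVec_C (y : ι → ℂ) :
    charmatrix N *ᵥ (fun i => C (y i)) = (X : ℂ[X]) • (fun i => C (y i)) -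
      fun i => C ((N *ᵥ y) i) := by
  ext1 i
  simp only [charmatrix, sub_mulVec, Pi.sub_apply, Pi.smul_apply, smul_eq_mul]
  congr 1
  · simp [mulVec_diagonal, Matrix.scalar_apply]
  · simp [mulVec, dotProduct]

lemma charpoly_mul_C (y : ι → ℂ) (i : ι) :
    N.charpoly * C (y i) = X * (adjugate (charmatrix N) *ᵥ fun i => C (y i)) i -
      (adjugate (charmatrix N) *ᵥ fun i => C ((N *ᵥ y) i)) i := by
  have h := congrArg (fun v => adjugate (charmatrix N) *ᵥ v) (charmatrix_mulVec_C N y)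
  simp only [mulVec_mulVec, adjugate_mul, mulVec_sub, mulVec_smul, smul_mulVec, one_mulVec] at h
  exact congrFun h i

variable {N}

/-- On a subspace `W ⊆ N W`, the polynomial vector `adj (X - N) z` vanishes at `0` to the order
of `0` as a root of the characteristic polynomial of `N`. -/
lemma X_pow_dvd_adjugate_mulVec {d : ℕ} (hd : X ^ d ∣ N.charpoly) {W : Set (ι → ℂ)}
    (hW : ∀ z ∈ W, ∃ y ∈ W, N *ᵥ y = z) {z : ι → ℂ} (hz : z ∈ W) (i : ι) :
    X ^ d ∣ (adjugate (charmatrix N) *ᵥ fun i => C (z i)) i := by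
  suffices ∀ k ≤ d, ∀ z ∈ W, ∀ i, X ^ k ∣ (adjugate (charmatrix N) *ᵥ fun i => C (z i)) i from
    this d le_rfl z hz i
  intro k
  induction k with
  | zero => simp
  | succ k ih =>
    intro hk z hz i
    obtain ⟨y, hy, rfl⟩ := hW z hz
    have h := charpoly_mul_C N y i
    have h1 : X ^ (k + 1) ∣ X * (adjugate (charmatrix N) *ᵥ fun i => C (y i)) i := by
      rw [pow_succ']
      exact mul_dvd_mul_left X (ih (by omega) y hy i)
    have h2 : X ^ (k + 1) ∣ N.charpoly * C (y i) :=
      ((pow_dvd_pow X hk).trans hd).mul_right _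
    rw [← sub_eq_iff_eq_add'.2 (eq_add_of_sub_eq h.symm)]
    exact dvd_sub h1 h2

/-- A rank one perturbation `N - w b` of `N` lowers the order of `0` as a root of the
characteristic polynomial by at most one, and the new leading coefficient at `0` only depends on
the component `k` of `w` in the kernel of `N`. -/
lemma charpoly_sub_vecMulVec {d : ℕ} (hd : X ^ (d + 1) ∣ N.charpoly) {W : Set (ι → ℂ)}
    (hW : ∀ z ∈ W, ∃ y ∈ W, N *ᵥ y = z) {k z : ι → ℂ} (hk : N *ᵥ k = 0) (hz : z ∈ W)
    (b : ι → ℂ) :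
    X ^ d ∣ (N - vecMulVec (k + z) b).charpoly ∧
      (N - vecMulVec (k + z) b).charpoly.coeff d = (b ⬝ᵥ k) * N.charpoly.coeff (d + 1) := by
  set bk : ℂ[X] := (fun i => C (b i)) ⬝ᵥ (adjugate (charmatrix N) *ᵥ fun i => C (k i)) with hbk
  set bz : ℂ[X] := (fun i => C (b i)) ⬝ᵥ (adjugate (charmatrix N) *ᵥ fun i => C (z i)) with hbz
  have h1 : (N - vecMulVec (k + z) b).charpoly = N.charpoly + (bk + bz) := by
    have e : charmatrix (N - vecMulVec (k + z) b) =
        charmatrix N + vecMulVec (fun i => C ((k + z) i)) (fun i => C (b i)) := by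
      ext1 i j
      simp [charmatrix, vecMulVec_apply]
      ring
    rw [charpoly, e, det_add_vecMulVec _ (charpoly_monic N).ne_zero, hbk, hbz, ← dotProduct_add,
      ← mulVec_add]
    congr 4
    ext1 i
    simp
  have h2 : X * bk = N.charpoly * C (b ⬝ᵥ k) := by
    have h : ∀ i, N.charpoly * C (k i) =
        X * (adjugate (charmatrix N) *ᵥ fun i => C (k i)) i := by
      intro i
      have h := charpoly_mul_C N k i
      rw [hk] at h
      have h0 : (fun i => C ((0 : ι → ℂ) i)) = (0 : ι → ℂ[X]) := by ext1 i; simp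
      rwa [h0, mulVec_zero, Pi.zero_apply, sub_zero] at h
    rw [hbk, dotProduct, dotProduct, Finset.mul_sum, map_sum, Finset.mul_sum]
    refine Finset.sum_congr rfl fun i _ => ?_
    rw [map_mul, mul_left_comm, ← h, mul_left_comm]
  have h3 : X ^ (d + 1) ∣ bz :=
    Finset.dvd_sum fun i _ => (X_pow_dvd_adjugate_mulVec hd hW hz i).mul_left _
  have h4 : X ^ d ∣ bk := by
    have : X * X ^ d ∣ X * bk := by
      rw [h2, ← pow_succ']
      exact hd.mul_right _
    exact (mul_dvd_mul_iff_left X_ne_zero).1 this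
  constructor
  · rw [h1]
    exact dvd_add ((pow_dvd_pow X d.le_succ).trans hd)
      (dvd_add h4 ((pow_dvd_pow X d.le_succ).trans h3))
  · have c1 : N.charpoly.coeff d = 0 := X_pow_dvd_iff.1 hd d d.lt_succ_self
    have c2 : bz.coeff d = 0 := X_pow_dvd_iff.1 h3 d d.lt_succ_self
    have c3 : bk.coeff d = (b ⬝ᵥ k) * N.charpoly.coeff (d + 1) := by
      rw [← coeff_X_mul, h2, coeff_mul_C, mul_comm]
    rw [h1, coeff_add, coeff_add, c1, c2, c3]
    ring

end RankOne

/-! ### The fixed space of a unitary matrix -/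

section Unitary

variable {n : ℕ}

/-- The eigenspace of `u` for the eigenvalue `1`. -/
def fixedSpace (u : Matrix (Fin n) (Fin n) ℂ) : Submodule ℂ (EuclideanSpace ℂ (Fin n)) :=
  LinearMap.ker (toEuclideanLin (u - 1))

variable {u : Matrix (Fin n) (Fin n) ℂ}

lemma mem_fixedSpace {y : EuclideanSpace ℂ (Fin n)} :
    y ∈ fixedSpace u ↔ u *ᵥ y.ofLp = y.ofLp := by
  rw [fixedSpace, LinearMap.mem_ker, toEuclideanLin, toLpLin_apply, sub_mulVec, one_mulVec]
  constructor
  · intro h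
    exact sub_eq_zero.1 (congrArg WithLp.ofLp h)
  · intro h
    rw [h, sub_self]
    rfl

lemma star_vecMul_eq (hu : u ∈ unitaryGroup (Fin n) ℂ) {y : Fin n → ℂ} (hy : u *ᵥ y = y) :
    star y ᵥ* u = star y := by
  have h : star u *ᵥ y = y := by
    conv_lhs => rw [← hy]
    rw [mulVec_mulVec, mem_unitaryGroup_iff'.1 hu, one_mulVec]
  have := star_mulVec (star u) y
  rw [h, star_eq_conjTranspose, conjTranspose_conjTranspose] at this
  exact this.symm

lemma range_eq_fixedSpace_orthogonal (hu : u ∈ unitaryGroup (Fin n) ℂ) :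
    LinearMap.range (toEuclideanLin (u - 1)) = (fixedSpace u)ᗮ := by
  apply Submodule.eq_of_le_of_finrank_eq
  · rintro _ ⟨y, rfl⟩
    rw [Submodule.mem_orthogonal]
    intro k hk
    have h := star_vecMul_eq hu (mem_fixedSpace.1 hk)
    rw [EuclideanSpace.inner_eq_star_dotProduct, toEuclideanLin, toLpLin_apply, dotProduct_comm]
    rw [sub_mulVec, dotProduct_sub, dotProduct_mulVec, h, one_mulVec, sub_self]
  · have h1 := LinearMap.finrank_range_add_finrank_ker (toEuclideanLin (u - 1))
    have h2 := Submodule.finrank_add_finrank_orthogonal (fixedSpace u)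
    rw [fixedSpace] at *
    omega

/-- `u - 1` is invertible on the orthogonal complement of the fixed space. -/
lemma exists_mulVec_eq (hu : u ∈ unitaryGroup (Fin n) ℂ) {z : EuclideanSpace ℂ (Fin n)}
    (hz : z ∈ (fixedSpace u)ᗮ) :
    ∃ y ∈ (fixedSpace u)ᗮ, (u - 1) *ᵥ y.ofLp = z.ofLp := by
  rw [← range_eq_fixedSpace_orthogonal hu] at hz
  obtain ⟨y, rfl⟩ := hz
  obtain ⟨k, hk, w, hw, rfl⟩ := (fixedSpace u).exists_add_mem_mem_orthogonal y
  refine ⟨w, hw, ?_⟩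
  have h0 : toEuclideanLin (u - 1) k = 0 := hk
  rw [map_add, h0, zero_add, toEuclideanLin, toLpLin_apply]

/-- For a unitary matrix the geometric and algebraic multiplicities of the eigenvalue `1` agree. -/
lemma finrank_fixedSpace (hu : u ∈ unitaryGroup (Fin n) ℂ) :
    Module.finrank ℂ (fixedSpace u) = (u - 1).charpoly.natTrailingDegree := by
  have h1 : (toEuclideanLin (u - 1)).charpoly = (u - 1).charpoly := by
    rw [← LinearMap.charpoly_toMatrix _ (EuclideanSpace.basisFun (Fin n) ℂ).toBasis]
    congr 1
    rw [toEuclideanLin_eq_toLin_orthonormal, LinearMap.toMatrix_toLin]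
  rw [← h1, ← LinearMap.finrank_maxGenEigenspace_zero_eq]
  have h2 : ∀ y, toEuclideanLin (u - 1) (toEuclideanLin (u - 1) y) = 0 →
      toEuclideanLin (u - 1) y = 0 := by
    intro y hy
    have hK : toEuclideanLin (u - 1) y ∈ fixedSpace u := hy
    have hK' : toEuclideanLin (u - 1) y ∈ (fixedSpace u)ᗮ := by
      rw [← range_eq_fixedSpace_orthogonal hu]
      exact ⟨y, rfl⟩
    exact inner_self_eq_zero.1 (hK' _ hK)
  have h3 : Module.End.maxGenEigenspace (toEuclideanLin (u - 1)) 0 = fixedSpace u := by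
    ext y
    rw [Module.End.mem_maxGenEigenspace]
    constructor
    · rintro ⟨k, hk⟩
      rw [zero_smul, sub_zero] at hk
      induction k with
      | zero =>
        rw [pow_zero] at hk
        have : y = 0 := hk
        rw [this]; exact zero_mem _
      | succ k ih =>
        cases k with
        | zero => simpa [fixedSpace] using hk
        | succ k =>
          apply ih
          rw [pow_succ', pow_succ'] at hk
          rw [pow_succ']
          exact h2 _ hk
    · intro hy
      exact ⟨1, by simpa [fixedSpace] using hy⟩
  rw [h3]

lemma charpolyDeriv_div_factorial (p : ℕ) (u : unitaryGroup (Fin n) ℂ) :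
    charpolyDeriv p u / (p.factorial : ℂ) =
      ((u : Matrix (Fin n) (Fin n) ℂ) - 1).charpoly.coeff p := by
  have h1 : (1 : Matrix (Fin n) (Fin n) ℂ) = scalar (Fin n) 1 := (map_one _).symm
  rw [h1, charpoly_sub_scalar, ← taylor_apply, taylor_coeff, charpolyDeriv,
    ← factorial_smul_hasseDeriv, LinearMap.smul_apply, eval_smul, nsmul_eq_mul,
    mul_div_cancel_left₀]
  exact_mod_cast p.factorial_ne_zero

/-- Multiplication by a reflection `r` turns the coefficient of `(X - 1) ^ (d + 1)` in the
characteristic polynomial of `u` into the coefficient of `(X - 1) ^ d` in that of `r u`, up to a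
factor which depends on `u` only through its fixed space. If `v j = 1`, the factor is `0` by the
convention `0⁻¹ = 0`, in agreement with `r = 1`. -/
lemma charpoly_reflectionMatrix_mul (hu : u ∈ unitaryGroup (Fin n) ℂ) {d : ℕ}
    (hd : X ^ (d + 1) ∣ (u - 1).charpoly) (j : Fin n) (v : Fin n → ℂ) :
    X ^ d ∣ (reflectionMatrix j v * u - 1).charpoly ∧
      (reflectionMatrix j v * u - 1).charpoly.coeff d =
        (u - 1).charpoly.coeff (d + 1) * ((1 - conj (v j))⁻¹ *
          (‖(fixedSpace u).starProjection (WithLp.toLp 2 (v - Pi.single j 1))‖ ^ 2 : ℝ)) := by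
  set w := v - Pi.single j 1 with hw
  set c := (1 - conj (v j))⁻¹
  set k := (fixedSpace u).starProjection (WithLp.toLp 2 w) with hk
  set z := WithLp.toLp 2 w - k with hz
  have hkK : k ∈ fixedSpace u := Submodule.starProjection_apply_mem _ _
  have hzK : z ∈ (fixedSpace u)ᗮ := Submodule.sub_starProjection_mem_orthogonal _
  have hkz : k.ofLp + z.ofLp = w := by simp [hz]
  have e : reflectionMatrix j v * u - 1 =
      (u - 1) - vecMulVec (k.ofLp + z.ofLp) (c • (star w ᵥ* u)) := by
    rw [hkz, reflectionMatrix, sub_mul, one_mul, smul_mul_assoc, vecMulVec_mul, vecMulVec_smul]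
    abel
  obtain ⟨h1, h2⟩ := charpoly_sub_vecMulVec hd
    (W := {z | WithLp.toLp 2 z ∈ (fixedSpace u)ᗮ})
    (fun z hz => by
      obtain ⟨y, hy, h⟩ := exists_mulVec_eq hu hz
      exact ⟨y.ofLp, hy, h⟩)
    (k := k.ofLp) (z := z.ofLp)
    (by rw [sub_mulVec, one_mulVec, mem_fixedSpace.1 hkK, sub_self]) hzK (c • (star w ᵥ* u))
  rw [e]
  refine ⟨h1, ?_⟩
  have h3 : star w ⬝ᵥ k.ofLp = ((‖k‖ ^ 2 : ℝ) : ℂ) := by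
    have h4 : inner ℂ (WithLp.toLp 2 w) k = ((‖k‖ ^ 2 : ℝ) : ℂ) := by
      have : WithLp.toLp 2 w = k + z := by simp [hz]
      rw [this, inner_add_left, Submodule.inner_left_of_mem_orthogonal hkK hzK, add_zero,
        inner_self_eq_norm_sq_to_K]
      simp
    rw [← h4, EuclideanSpace.inner_eq_star_dotProduct, dotProduct_comm]
  rw [h2, smul_dotProduct, ← dotProduct_mulVec, mem_fixedSpace.1 hkK, h3, smul_eq_mul, mul_comm]

end Unitary

end CondHaar

namespace CondHaar

open Set

/-! ### Integration in polar coordinates and under scalings -/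

section Haar

variable {V : Type*} [NormedAddCommGroup V] [NormedSpace ℝ V] [FiniteDimensional ℝ V]
  [MeasurableSpace V] [BorelSpace V] (μ : Measure V) [μ.IsAddHaarMeasure]

lemma lintegral_polar {F : V → ℝ≥0∞} (hF : Measurable F) [Nontrivial V] :
    ∫⁻ v, F v ∂μ = ∫⁻ x : Metric.sphere (0 : V) 1,
      ∫⁻ r : Ioi (0 : ℝ), F (r.1 • x.1) ∂.volumeIoiPow (Module.finrank ℝ V - 1) ∂μ.toSphere := by
  have h1 := μ.measurePreserving_homeomorphUnitSphereProd
  have h2 : ∫⁻ v, F v ∂μ = ∫⁻ v : ({0}ᶜ : Set V), F v ∂(μ.comap (↑)) := by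
    rw [lintegral_subtype_comap (measurableSet_singleton _).compl, restrict_compl_singleton]
  have hG : Measurable (fun y : Metric.sphere (0 : V) 1 × Ioi (0 : ℝ) => F (y.2.1 • y.1.1)) := by
    fun_prop
  rw [h2, ← lintegral_prod _ hG.aemeasurable, ← h1.lintegral_comp hG]
  refine lintegral_congr fun v => ?_
  have hv : ‖v.1‖ ≠ 0 := norm_ne_zero_iff.2 v.2
  congr 1
  simp [smul_smul, hv]

/-- The integral over the sphere of a function that is constant along rays. -/
lemma exists_lintegral_toSphere [Nontrivial V] :
    ∃ K : ℝ≥0∞, ∀ F : V → ℝ≥0∞, Measurable F → (∀ r : ℝ, 0 < r → ∀ v, F (r • v) = F v) →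
      ∫⁻ x : Metric.sphere (0 : V) 1, F x ∂μ.toSphere =
        K * ∫⁻ v, F v * (Iio (1 : ℝ)).indicator 1 ‖v‖ ∂μ := by
  set I : ℝ≥0∞ := Measure.volumeIoiPow (Module.finrank ℝ V - 1)
    (Iio (⟨1, mem_Ioi.2 one_pos⟩ : Ioi (0 : ℝ)))
  have hI : I = ENNReal.ofReal (1 ^ (Module.finrank ℝ V - 1 + 1) /
    ((Module.finrank ℝ V - 1 : ℕ) + 1)) := Measure.volumeIoiPow_apply_Iio _ _
  have hI0 : I ≠ 0 := by
    rw [hI, Ne, ENNReal.ofReal_eq_zero, not_le]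
    positivity
  have hI1 : I ≠ ⊤ := by rw [hI]; exact ENNReal.ofReal_ne_top
  refine ⟨I⁻¹, fun F hF hF' => ?_⟩
  have hg : Measurable (fun v : V => F v * (Iio (1 : ℝ)).indicator (1 : ℝ → ℝ≥0∞) ‖v‖) :=
    hF.mul ((measurable_one.indicator measurableSet_Iio).comp measurable_norm)
  rw [lintegral_polar μ hg]
  have h1 : ∀ x : Metric.sphere (0 : V) 1,
      ∫⁻ r : Ioi (0 : ℝ), F (r.1 • x.1) * (Iio (1 : ℝ)).indicator 1 ‖r.1 • x.1‖
        ∂.volumeIoiPow (Module.finrank ℝ V - 1) = F x * I := by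
    intro x
    have h2 : ∀ r : Ioi (0 : ℝ), F (r.1 • x.1) * (Iio (1 : ℝ)).indicator 1 ‖r.1 • x.1‖ =
        F x * (Iio (⟨1, mem_Ioi.2 one_pos⟩ : Ioi (0 : ℝ))).indicator 1 r := by
      intro r
      have hr : 0 < r.1 := r.2
      have hx : ‖x.1‖ = 1 := by simp
      rw [hF' _ hr, norm_smul, hx, mul_one, Real.norm_of_nonneg hr.le]
      congr 1
    simp_rw [h2]
    rw [lintegral_const_mul _ (measurable_one.indicator measurableSet_Iio),
      lintegral_indicator_one measurableSet_Iio]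
  simp_rw [h1]
  rw [lintegral_mul_const _ (by fun_prop), mul_comm _ I, ← mul_assoc,
    ENNReal.inv_mul_cancel hI0 hI1, one_mul]

lemma exists_lintegral_fun_norm [Nontrivial V] :
    ∃ K : ℝ≥0∞, ∀ F : ℝ → ℝ≥0∞, Measurable F →
      ∫⁻ v, F ‖v‖ ∂μ =
        K * ∫⁻ y in Ioi (0 : ℝ), ENNReal.ofReal (y ^ (Module.finrank ℝ V - 1)) * F y := by
  refine ⟨μ.toSphere univ, fun F hF => ?_⟩
  rw [lintegral_polar μ (by fun_prop)]
  have h1 : ∀ x : Metric.sphere (0 : V) 1, ∀ r : Ioi (0 : ℝ), F ‖r.1 • x.1‖ = F r := by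
    intro x r
    have hr : 0 < r.1 := r.2
    have hx : ‖x.1‖ = 1 := by simp
    rw [norm_smul, hx, mul_one, Real.norm_of_nonneg hr.le]
  simp_rw [h1]
  rw [lintegral_const, mul_comm, Measure.volumeIoiPow,
    lintegral_withDensity_eq_lintegral_mul _ (by fun_prop) (by fun_prop)]
  simp only [Pi.mul_apply]
  rw [lintegral_subtype_comap measurableSet_Ioi
    (fun y : ℝ => ENNReal.ofReal (y ^ (Module.finrank ℝ V - 1)) * F y)]

lemma lintegral_smul_pos {F : V → ℝ≥0∞} (hF : Measurable F) {s : ℝ} (hs : 0 < s) :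
    ∫⁻ v, F v ∂μ = ENNReal.ofReal (s ^ Module.finrank ℝ V) * ∫⁻ v, F (s • v) ∂μ := by
  have h := Measure.map_addHaar_smul μ hs.ne'
  rw [← lintegral_map (g := fun x => s • x) hF (by fun_prop), h, lintegral_smul_measure, smul_eq_mul, ← mul_assoc,
    ← ENNReal.ofReal_mul (by positivity), abs_of_pos (by positivity),
    mul_inv_cancel₀ (by positivity), ENNReal.ofReal_one, one_mul]

end Haar

lemma exists_lintegral_comp_equiv {V W : Type*} [NormedAddCommGroup V] [NormedSpace ℝ V]
    [MeasurableSpace V] [BorelSpace V] (μ : Measure V) [μ.IsAddHaarMeasure] [NormedAddCommGroup W] [NormedSpace ℝ W]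
    [FiniteDimensional ℝ W] [MeasurableSpace W] [BorelSpace W] (ν : Measure W)
    [ν.IsAddHaarMeasure] (M : W ≃L[ℝ] V) :
    ∃ K : ℝ≥0∞, ∀ F : V → ℝ≥0∞, Measurable F → ∫⁻ v, F v ∂μ = K * ∫⁻ w, F (M w) ∂ν := by
  have : (μ.map M.symm).IsAddHaarMeasure := M.symm.isAddHaarMeasure_map μ
  have h := Measure.isAddLeftInvariant_eq_smul (μ.map M.symm) ν
  refine ⟨(μ.map M.symm).addHaarScalarFactor ν, fun F hF => ?_⟩
  have hM : Measurable M := M.continuous.measurable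
  have hM' : Measurable M.symm := M.symm.continuous.measurable
  have h2 : ∫⁻ v, F v ∂μ = ∫⁻ w, F (M w) ∂(μ.map M.symm) := by
    rw [lintegral_map (f := fun w => F (M w)) (hF.comp hM) hM']
    simp
  rw [h2]
  conv_lhs => rw [h]
  rw [lintegral_smul_measure]
  rfl

/-! ### A half-plane model of the plane -/

section Cayley

/-- The substitution `z = √(x² + D) - x`. -/
lemma lintegral_sqrt_sub {D : ℝ} (hD : 0 < D) (F : ℝ → ℝ≥0∞) :
    ∫⁻ x, F x = ∫⁻ z in Ioi (0 : ℝ),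
      ENNReal.ofReal ((z ^ 2 + D) / (2 * z) / z) * F ((z ^ 2 + D) / (2 * z) - z) := by
  set φ : ℝ → ℝ := fun z => (z ^ 2 + D) / (2 * z) - z with hφ
  have hinj : InjOn φ (Ioi 0) := by
    intro z hz w hw h
    have hz' : 0 < z := hz
    have hw' : 0 < w := hw
    simp only [hφ] at h
    field_simp at h
    have : (z - w) * (z * w + D) = 0 := by linear_combination (-1) * h
    rcases mul_eq_zero.1 this with h | h
    · linarith
    · nlinarith [mul_pos hz' hw']
  have himage : φ '' Ioi 0 = univ := by
    refine eq_univ_of_forall fun x => ?_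
    have h0 : |x| < √(x ^ 2 + D) := by
      rw [← Real.sqrt_sq_eq_abs]
      exact Real.sqrt_lt_sqrt (sq_nonneg _) (by linarith)
    have h1 : 0 < √(x ^ 2 + D) - x := by linarith [le_abs_self x]
    refine ⟨√(x ^ 2 + D) - x, h1, ?_⟩
    have h2 : √(x ^ 2 + D) ^ 2 = x ^ 2 + D := Real.sq_sqrt (by positivity)
    simp only [hφ]
    generalize √(x ^ 2 + D) = s at *
    have : s - x ≠ 0 := h1.ne'
    field_simp
    linear_combination (-1) * h2
  have hderiv : ∀ z ∈ Ioi (0 : ℝ), HasDerivWithinAt φ (-((z ^ 2 + D) / (2 * z) / z)) (Ioi 0) z := by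
    intro z hz
    have hz' : z ≠ 0 := (mem_Ioi.1 hz).ne'
    have h1 : HasDerivAt (fun z : ℝ => z ^ 2 + D) (2 * z) z := by
      simpa using (hasDerivAt_pow 2 z).add_const D
    have h2 : HasDerivAt (fun z : ℝ => 2 * z) 2 z := by
      simpa using (hasDerivAt_id z).const_mul 2
    have h3 := (h1.div h2 (by positivity)).sub (hasDerivAt_id z)
    refine (h3.congr_deriv ?_).hasDerivWithinAt
    field_simp
    ring
  have h := lintegral_image_eq_lintegral_abs_deriv_mul measurableSet_Ioi hderiv hinj F
  rw [himage, Measure.restrict_univ] at h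
  rw [h]
  refine setLIntegral_congr_fun measurableSet_Ioi fun z hz => ?_
  have hz' : 0 < z := hz
  simp only [hφ]
  rw [abs_neg, abs_of_pos (by positivity)]

/-- The half-plane `Re z > 0`. -/
abbrev rightHalfPlane : Set ℂ := {z | 0 < z.re}

lemma measurableSet_rightHalfPlane : MeasurableSet rightHalfPlane :=
  measurableSet_lt measurable_const Complex.measurable_re

/-- If `conj z = r - a` with `r ^ 2 = ‖a‖ ^ 2 + d`, this is `r` as a function of `z`. -/
def radius (z : ℂ) (d : ℝ) : ℝ := (‖z‖ ^ 2 + d) / (2 * z.re)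

@[fun_prop]
lemma measurable_radius : Measurable (fun p : ℂ × ℝ => radius p.1 p.2) := by
  unfold radius
  fun_prop

lemma radius_pos {z : ℂ} (hz : 0 < z.re) {d : ℝ} (hd : 0 ≤ d) : 0 < radius z d := by
  have : z ≠ 0 := by rintro rfl; simp at hz
  unfold radius
  positivity

/-- For fixed `d`, the map `a ↦ z = √(‖a‖ ^ 2 + d) - conj a` is a bijection from the plane (up to
a null set) to the half-plane `Re z > 0`, with Jacobian `Re z / √(‖a‖ ^ 2 + d)`. -/
lemma lintegral_rightHalfPlane {d : ℝ} (hd : 0 ≤ d) {G : ℂ → ℝ≥0∞} (hG : Measurable G) :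
    ∫⁻ a, G a = ∫⁻ z in rightHalfPlane,
      ENNReal.ofReal (radius z d / z.re) * G (radius z d - conj z) := by
  have hr : Measurable fun z : ℂ => radius z d :=
    measurable_radius.comp (measurable_id.prodMk measurable_const)
  have hm : Measurable fun z : ℂ => ENNReal.ofReal (radius z d / z.re) *
      G (radius z d - conj z) := by
    refine Measurable.mul ?_ (hG.comp ?_)
    · fun_prop
    · exact (Complex.measurable_ofReal.comp hr).sub Complex.continuous_conj.measurable
  have e := Complex.volume_preserving_equiv_real_prod.symm
  rw [← lintegral_indicator measurableSet_rightHalfPlane, ← e.lintegral_comp hG,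
    ← e.lintegral_comp (hm.indicator measurableSet_rightHalfPlane)]
  change ∫⁻ p, _ ∂(volume.prod volume) = ∫⁻ p, _ ∂(volume.prod volume)
  rw [lintegral_prod_symm _ (by exact (hG.comp e.measurable).aemeasurable),
    lintegral_prod_symm _ (by
      exact ((hm.indicator measurableSet_rightHalfPlane).comp e.measurable).aemeasurable)]
  -- The one-dimensional substitution needs `y ^ 2 + d ≠ 0`.
  have hy0 : ∀ᵐ y : ℝ, y ≠ 0 := by
    simp [ae_iff]
  refine lintegral_congr_ae ?_
  filter_upwards [hy0] with y hy
  have hD : 0 < y ^ 2 + d := by positivity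
  rw [lintegral_sqrt_sub hD, ← lintegral_indicator measurableSet_Ioi]
  refine lintegral_congr fun x => ?_
  by_cases hx : 0 < x
  · rw [indicator_of_mem (show x ∈ Ioi (0 : ℝ) from hx),
      indicator_of_mem (show Complex.measurableEquivRealProd.symm (x, y) ∈ rightHalfPlane from hx)]
    have h1 : radius (Complex.measurableEquivRealProd.symm (x, y)) d =
        (x ^ 2 + (y ^ 2 + d)) / (2 * x) := by
      simp only [radius, Complex.measurableEquivRealProd_symm_apply, Complex.sq_norm,
        Complex.normSq_mk]
      ring
    rw [h1]
    generalize (x ^ 2 + (y ^ 2 + d)) / (2 * x) = s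
    congr 2
    apply Complex.ext <;>
      simp [Complex.measurableEquivRealProd_symm_apply]
  · rw [indicator_of_notMem (show x ∉ Ioi (0 : ℝ) from hx),
      indicator_of_notMem
        (show Complex.measurableEquivRealProd.symm (x, y) ∉ rightHalfPlane from hx)]

lemma radius_eq_sqrt {z : ℂ} (hz : 0 < z.re) {d : ℝ} (hd : 0 ≤ d) :
    √(‖(radius z d : ℂ) - conj z‖ ^ 2 + d) = radius z d := by
  rw [Real.sqrt_eq_iff_mul_self_eq (by positivity) (radius_pos hz hd).le]
  have h : ‖(radius z d : ℂ) - conj z‖ ^ 2 =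
      radius z d ^ 2 - 2 * radius z d * z.re + ‖z‖ ^ 2 := by
    simp only [Complex.sq_norm, Complex.normSq_apply]
    simp
    ring
  have h2 : 2 * radius z d * z.re = ‖z‖ ^ 2 + d := by
    unfold radius
    field_simp
  rw [h]
  linarith

end Cayley

/-! ### Reduction of the one-factor law to a weight -/

section Factor

@[fun_prop]
lemma measurable_conj : Measurable (fun z : ℂ => conj z) := Complex.continuous_conj.measurable

lemma lintegral_rotate {α β γ : Type*} [MeasurableSpace α] [MeasurableSpace β]
    [MeasurableSpace γ] (μ : Measure α) (ν : Measure β) (τ : Measure γ) [SFinite μ] [SFinite ν]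
    [SFinite τ] {F : α → β → γ → ℝ≥0∞} (hF : Measurable fun x : α × β × γ => F x.1 x.2.1 x.2.2) :
    ∫⁻ x, ∫⁻ y, ∫⁻ z, F x y z ∂τ ∂ν ∂μ = ∫⁻ z, ∫⁻ x, ∫⁻ y, F x y z ∂ν ∂μ ∂τ := by
  have h1 : ∀ x, ∫⁻ y, ∫⁻ z, F x y z ∂τ ∂ν = ∫⁻ z, ∫⁻ y, F x y z ∂ν ∂τ := fun x =>
    lintegral_lintegral_swap
      (hF.comp (f := fun y : β × γ => (x, y)) (by fun_prop)).aemeasurable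
  simp_rw [h1]
  refine lintegral_lintegral_swap (Measurable.aemeasurable ?_)
  refine Measurable.lintegral_prod_right' (f := fun w : (α × γ) × β => F w.1.1 w.2 w.1.2) ?_
  exact hF.comp (f := fun w : (α × γ) × β => (w.1.1, w.2, w.1.2)) (by fun_prop)

variable {C B : Type*} [NormedAddCommGroup C] [NormedSpace ℝ C] [FiniteDimensional ℝ C]
  [MeasurableSpace C] [BorelSpace C] (μC : Measure C) [μC.IsAddHaarMeasure]
  [NormedAddCommGroup B] [NormedSpace ℝ B] [FiniteDimensional ℝ B]
  [MeasurableSpace B] [BorelSpace B] (μB : Measure B) [μB.IsAddHaarMeasure]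

/-- In the coordinates `z = r - conj a` of the half-plane, scaling `c` and `b` by suitable factors
turns the ratio `(‖r - a‖² + ‖c‖²) / (r conj (r - a))` into `1 - a / r`, at the price of a weight
`‖1 - a / r‖ ^ (2 p)`. -/
lemma lintegral_ratio_eq {p q : ℕ} (hp : Module.finrank ℝ C = 2 * p)
    (hq : Module.finrank ℝ B = 2 * q) {f : ℂ → ℝ≥0∞} (hf : Measurable f) {g : ℝ → ℝ≥0∞}
    (hg : Measurable g) :
    ∫⁻ c, ∫⁻ b, ∫⁻ a : ℂ,
      f (((‖(√(‖a‖ ^ 2 + (‖c‖ ^ 2 + ‖b‖ ^ 2)) : ℂ) - a‖ ^ 2 + ‖c‖ ^ 2 : ℝ) : ℂ) /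
        ((√(‖a‖ ^ 2 + (‖c‖ ^ 2 + ‖b‖ ^ 2)) : ℂ) *
          conj ((√(‖a‖ ^ 2 + (‖c‖ ^ 2 + ‖b‖ ^ 2)) : ℂ) - a))) *
        g √(‖a‖ ^ 2 + (‖c‖ ^ 2 + ‖b‖ ^ 2)) ∂volume ∂μB ∂μC =
    ∫⁻ b, ∫⁻ a : ℂ, (ENNReal.ofReal (‖1 - a / (√(‖a‖ ^ 2 + ‖b‖ ^ 2) : ℂ)‖ ^ (2 * p)) *
        f (1 - a / (√(‖a‖ ^ 2 + ‖b‖ ^ 2) : ℂ))) *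
      ∫⁻ h : C, ENNReal.ofReal (√(‖a‖ ^ 2 + ‖b‖ ^ 2) ^ (2 * p)) *
        ENNReal.ofReal ((1 + ‖h‖ ^ 2) ^ (q + 1)) *
        g ((1 + ‖h‖ ^ 2) * √(‖a‖ ^ 2 + ‖b‖ ^ 2)) ∂μC ∂volume ∂μB := by
  -- The integrand in the coordinates `z`, `c`, `b`, with `s = ‖c‖²` and `t = ‖b‖²`.
  set Φ : ℂ → ℝ → ℝ → ℝ≥0∞ := fun z s t =>
    ENNReal.ofReal (radius z (s + t) / z.re) *
      (f (((‖z‖ ^ 2 + s : ℝ) : ℂ) / ((radius z (s + t) : ℂ) * z)) * g (radius z (s + t))) with hΦ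
  have hr : Measurable fun w : ℂ × ℝ × ℝ => radius w.1 (w.2.1 + w.2.2) :=
    measurable_radius.comp (f := fun w : ℂ × ℝ × ℝ => (w.1, w.2.1 + w.2.2)) (by fun_prop)
  have hΦm : Measurable fun w : ℂ × ℝ × ℝ => Φ w.1 w.2.1 w.2.2 := by
    simp only [hΦ]
    fun_prop
  -- The integrand of the right-hand side, before integration over `h`.
  set G : C → B → ℂ → ℝ≥0∞ := fun h b a =>
    (ENNReal.ofReal (‖1 - a / (√(‖a‖ ^ 2 + ‖b‖ ^ 2) : ℂ)‖ ^ (2 * p)) *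
        f (1 - a / (√(‖a‖ ^ 2 + ‖b‖ ^ 2) : ℂ))) *
      (ENNReal.ofReal (√(‖a‖ ^ 2 + ‖b‖ ^ 2) ^ (2 * p)) *
        ENNReal.ofReal ((1 + ‖h‖ ^ 2) ^ (q + 1)) *
        g ((1 + ‖h‖ ^ 2) * √(‖a‖ ^ 2 + ‖b‖ ^ 2))) with hG
  have hGm : Measurable fun w : C × B × ℂ => G w.1 w.2.1 w.2.2 := by
    simp only [hG]
    fun_prop
  have step1 : ∀ (c : C) (b : B), ∫⁻ a : ℂ,
      f (((‖(√(‖a‖ ^ 2 + (‖c‖ ^ 2 + ‖b‖ ^ 2)) : ℂ) - a‖ ^ 2 + ‖c‖ ^ 2 : ℝ) : ℂ) /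
        ((√(‖a‖ ^ 2 + (‖c‖ ^ 2 + ‖b‖ ^ 2)) : ℂ) *
          conj ((√(‖a‖ ^ 2 + (‖c‖ ^ 2 + ‖b‖ ^ 2)) : ℂ) - a))) *
        g √(‖a‖ ^ 2 + (‖c‖ ^ 2 + ‖b‖ ^ 2)) =
      ∫⁻ z in rightHalfPlane, Φ z (‖c‖ ^ 2) (‖b‖ ^ 2) := by
    intro c b
    have hd : 0 ≤ ‖c‖ ^ 2 + ‖b‖ ^ 2 := by positivity
    rw [lintegral_rightHalfPlane hd (by fun_prop)]
    refine setLIntegral_congr_fun measurableSet_rightHalfPlane fun z hz => ?_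
    simp only [hΦ]
    rw [radius_eq_sqrt hz hd, sub_sub_cancel, Complex.conj_conj, RCLike.norm_conj]
  have step2 : ∀ z ∈ rightHalfPlane, ∫⁻ c, ∫⁻ b, Φ z (‖c‖ ^ 2) (‖b‖ ^ 2) ∂μB ∂μC =
      ∫⁻ h, ∫⁻ b, ENNReal.ofReal (radius z (‖b‖ ^ 2) / z.re) *
        G h b (radius z (‖b‖ ^ 2) - conj z) ∂μB ∂μC := by
    intro z hz
    have hz0 : z ≠ 0 := by rintro rfl; simp at hz
    have hzn : 0 < ‖z‖ := norm_pos_iff.2 hz0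
    rw [lintegral_smul_pos μC (by
      refine Measurable.lintegral_prod_right' (f := fun w : C × B => Φ z (‖w.1‖ ^ 2) (‖w.2‖ ^ 2)) ?_
      exact hΦm.comp (f := fun w : C × B => (z, ‖w.1‖ ^ 2, ‖w.2‖ ^ 2)) (by fun_prop)) hzn,
      ← lintegral_const_mul _ (by
      refine Measurable.lintegral_prod_right'
        (f := fun w : C × B => Φ z (‖‖z‖ • w.1‖ ^ 2) (‖w.2‖ ^ 2)) ?_
      exact hΦm.comp (f := fun w : C × B => (z, ‖‖z‖ • w.1‖ ^ 2, ‖w.2‖ ^ 2)) (by fun_prop))]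
    refine lintegral_congr fun h => ?_
    have hκ : 0 < √(1 + ‖h‖ ^ 2) := by positivity
    have hκ2 : √(1 + ‖h‖ ^ 2) ^ 2 = 1 + ‖h‖ ^ 2 := Real.sq_sqrt (by positivity)
    rw [lintegral_smul_pos μB (by
      exact hΦm.comp (f := fun w : B => (z, ‖‖z‖ • h‖ ^ 2, ‖w‖ ^ 2)) (by fun_prop)) hκ,
      ← lintegral_const_mul _ (by
      exact hΦm.comp (f := fun w : B => (z, ‖‖z‖ • h‖ ^ 2, ‖√(1 + ‖h‖ ^ 2) • w‖ ^ 2))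
        (by fun_prop)),
      ← lintegral_const_mul _ (by
      refine Measurable.const_mul ?_ _
      exact hΦm.comp (f := fun w : B => (z, ‖‖z‖ • h‖ ^ 2, ‖√(1 + ‖h‖ ^ 2) • w‖ ^ 2))
        (by fun_prop))]
    refine lintegral_congr fun b => ?_
    rw [hp, hq, pow_mul √(1 + ‖h‖ ^ 2), hκ2]
    set κ := 1 + ‖h‖ ^ 2 with hκdef
    have hκ0 : 0 < κ := by positivity
    have n1 : ‖‖z‖ • h‖ ^ 2 = ‖z‖ ^ 2 * ‖h‖ ^ 2 := by rw [norm_smul, norm_norm, mul_pow]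
    have n2 : ‖√κ • b‖ ^ 2 = κ * ‖b‖ ^ 2 := by
      rw [norm_smul, mul_pow, Real.norm_of_nonneg hκ.le, hκ2]
    have hR : radius z (‖z‖ ^ 2 * ‖h‖ ^ 2 + κ * ‖b‖ ^ 2) = κ * radius z (‖b‖ ^ 2) := by
      simp only [radius, hκdef]
      ring
    have hR0 : 0 < radius z (‖b‖ ^ 2) := radius_pos hz (by positivity)
    simp only [hΦ, hG]
    rw [n1, n2, hR, radius_eq_sqrt hz (by positivity)]
    set R := radius z (‖b‖ ^ 2)
    have hRC : (R : ℂ) ≠ 0 := by exact_mod_cast hR0.ne'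
    have hκC : (κ : ℂ) ≠ 0 := by exact_mod_cast hκ0.ne'
    have e1 : 1 - ((R : ℂ) - conj z) / R = conj z / R := by
      field_simp
      ring
    have e2 : ((‖z‖ ^ 2 + ‖z‖ ^ 2 * ‖h‖ ^ 2 : ℝ) : ℂ) / (((κ * R : ℝ) : ℂ) * z) = conj z / R := by
      have : ((‖z‖ ^ 2 + ‖z‖ ^ 2 * ‖h‖ ^ 2 : ℝ) : ℂ) = κ * (conj z * z) := by
        rw [Complex.conj_mul', hκdef]
        push_cast
        ring
      rw [this]
      push_cast
      field_simp
    rw [e1, e2, norm_div, RCLike.norm_conj, Complex.norm_of_nonneg hR0.le]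
    have e3 : ENNReal.ofReal (‖z‖ ^ (2 * p)) * (ENNReal.ofReal (κ ^ q) *
        ENNReal.ofReal (κ * R / z.re)) = ENNReal.ofReal (R / z.re) *
        ENNReal.ofReal ((‖z‖ / R) ^ (2 * p)) * ENNReal.ofReal (R ^ (2 * p)) *
        ENNReal.ofReal (κ ^ (q + 1)) := by
      have hz' : 0 < z.re := hz
      rw [← ENNReal.ofReal_mul (by positivity), ← ENNReal.ofReal_mul (by positivity),
        ← ENNReal.ofReal_mul (by positivity), ← ENNReal.ofReal_mul (by positivity),
        ← ENNReal.ofReal_mul (by positivity)]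
      congr 1
      rw [div_pow]
      field_simp
      ring
    calc _ = ENNReal.ofReal (‖z‖ ^ (2 * p)) * (ENNReal.ofReal (κ ^ q) *
        ENNReal.ofReal (κ * R / z.re)) * (f (conj z / R) * g (κ * R)) := by ring
      _ = _ := by rw [e3]; ring
  have hGm' : Measurable fun w : C × B × ℂ =>
      ENNReal.ofReal (radius w.2.2 (‖w.2.1‖ ^ 2) / w.2.2.re) *
        G w.1 w.2.1 (radius w.2.2 (‖w.2.1‖ ^ 2) - conj w.2.2) := by
    have hr' : Measurable fun w : C × B × ℂ => radius w.2.2 (‖w.2.1‖ ^ 2) :=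
      measurable_radius.comp (f := fun w : C × B × ℂ => (w.2.2, ‖w.2.1‖ ^ 2)) (by fun_prop)
    refine Measurable.mul (by fun_prop) ?_
    exact hGm.comp (f := fun w : C × B × ℂ =>
      (w.1, w.2.1, (radius w.2.2 (‖w.2.1‖ ^ 2) : ℂ) - conj w.2.2)) (by fun_prop)
  have hGm1 : ∀ h b, Measurable (G h b) := fun h b =>
    hGm.comp (f := fun a : ℂ => (h, b, a)) (by fun_prop)
  -- Integrate over `z` last, rescale `c` and `b`, and return to the coordinate `a`.
  simp_rw [step1]
  rw [lintegral_rotate μC μB (volume.restrict rightHalfPlane) (by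
      exact hΦm.comp (f := fun w : C × B × ℂ => (w.2.2, ‖w.1‖ ^ 2, ‖w.2.1‖ ^ 2)) (by fun_prop)),
    setLIntegral_congr_fun measurableSet_rightHalfPlane step2,
    ← lintegral_rotate μC μB (volume.restrict rightHalfPlane) hGm']
  simp_rw [← lintegral_rightHalfPlane (sq_nonneg ‖_‖) (hGm1 _ _)]
  rw [← lintegral_rotate μB volume μC (F := fun b a h => G h b a)
    (hGm.comp (f := fun w : B × ℂ × C => (w.2.2, w.1, w.2.1)) (by fun_prop))]
  refine lintegral_congr fun b => lintegral_congr fun a => ?_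
  simp only [hG]
  rw [lintegral_const_mul _ (by fun_prop)]

end Factor

/-! ### The law `diskLaw` -/

section Disk

instance isProbabilityMeasure_betaLaw (q : ℕ) : IsProbabilityMeasure (betaLaw q) := by
  unfold betaLaw
  split_ifs with h
  · infer_instance
  · exact isProbabilityMeasureBeta one_pos (by positivity)

lemma lintegral_diskLaw (q : ℕ) {ψ : ℂ → ℝ≥0∞} (hψ : Measurable ψ) :
    ∫⁻ x, ψ x ∂diskLaw q = (ENNReal.ofReal (2 * Real.pi))⁻¹ *
      ∫⁻ x, ∫⁻ θ in Ioo (-Real.pi) Real.pi, ψ (Complex.exp (θ * Complex.I) * (√x : ℂ))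
        ∂volume ∂betaLaw q := by
  rw [diskLaw, lintegral_map hψ (by fun_prop), lintegral_prod_symm _ (by fun_prop),
    ← lintegral_const_mul _ (Measurable.lintegral_prod_right' (f := fun w : ℝ × ℝ =>
      ψ (Complex.exp (w.2 * Complex.I) * (√w.1 : ℂ))) (by fun_prop))]
  refine lintegral_congr fun x => ?_
  rw [ProbabilityTheory.cond, lintegral_smul_measure, Real.volume_Ioo, smul_eq_mul]
  congr 3
  ring

lemma lintegral_betaLaw_succ (q : ℕ) {F : ℝ → ℝ≥0∞} (hF : Measurable F) :
    ∫⁻ x, F x ∂betaLaw (q + 1) = ENNReal.ofReal (1 / beta 1 (q + 1)) *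
      ∫⁻ x in Ioo (0 : ℝ) 1, ENNReal.ofReal ((1 - x) ^ q) * F x := by
  have hm : Measurable (betaPDF 1 ((q + 1 : ℕ) : ℝ)) :=
    (measurable_betaPDFReal _ _).ennreal_ofReal
  rw [betaLaw, if_neg q.succ_ne_zero, betaMeasure, lintegral_withDensity_eq_lintegral_mul _ hm hF,
    ← lintegral_const_mul _ (by fun_prop), ← lintegral_indicator measurableSet_Ioo]
  refine lintegral_congr fun x => ?_
  have hb : 0 < beta 1 ((q : ℝ) + 1) := beta_pos one_pos (by positivity)
  by_cases hx : x ∈ Ioo (0 : ℝ) 1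
  · rw [indicator_of_mem hx, Pi.mul_apply, betaPDF_of_pos_lt_one hx.1 hx.2, ← mul_assoc,
      ← ENNReal.ofReal_mul (by positivity)]
    simp
  · rw [indicator_of_notMem hx, Pi.mul_apply, betaPDF_eq, if_neg (by exact hx)]
    simp

/-- The substitution `x = 1 / (1 + y²)`. -/
lemma lintegral_Ioo_eq (W : ℝ → ℝ≥0∞) :
    ∫⁻ x in Ioo (0 : ℝ) 1, W x =
      ∫⁻ y in Ioi (0 : ℝ), ENNReal.ofReal (2 * y / (1 + y ^ 2) ^ 2) * W (1 + y ^ 2)⁻¹ := by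
  set φ : ℝ → ℝ := fun y => (1 + y ^ 2)⁻¹ with hφ
  have hinj : InjOn φ (Ioi 0) := by
    intro y hy z hz h
    have h1 : 1 + y ^ 2 = 1 + z ^ 2 := inv_injective h
    exact (pow_left_inj₀ (mem_Ioi.1 hy).le (mem_Ioi.1 hz).le two_ne_zero).1 (by linarith)
  have himage : φ '' Ioi 0 = Ioo 0 1 := by
    ext x
    constructor
    · rintro ⟨y, hy, rfl⟩
      have hy' : 0 < y := hy
      exact ⟨by positivity, inv_lt_one_of_one_lt₀ (by nlinarith)⟩
    · rintro ⟨h0, h1⟩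
      have h2 : 0 < x⁻¹ - 1 := by linarith [(one_lt_inv₀ h0).2 h1]
      exact ⟨√(x⁻¹ - 1), Real.sqrt_pos.2 h2, by simp [hφ, Real.sq_sqrt h2.le]⟩
  have hderiv : ∀ y ∈ Ioi (0 : ℝ), HasDerivWithinAt φ (-(2 * y / (1 + y ^ 2) ^ 2)) (Ioi 0) y := by
    intro y hy
    have h1 : HasDerivAt (fun y : ℝ => 1 + y ^ 2) (2 * y) y := by
      simpa using (hasDerivAt_pow 2 y).const_add 1
    refine ((h1.inv (by positivity)).congr_deriv ?_).hasDerivWithinAt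
    ring
  rw [← himage, lintegral_image_eq_lintegral_abs_deriv_mul measurableSet_Ioi hderiv hinj W]
  refine setLIntegral_congr_fun measurableSet_Ioi fun y hy => ?_
  have hy' : 0 < y := hy
  simp only [hφ]
  rw [abs_neg, abs_of_pos (by positivity)]

variable {B : Type*} [NormedAddCommGroup B] [NormedSpace ℝ B] [FiniteDimensional ℝ B]
  [MeasurableSpace B] [BorelSpace B] (μB : Measure B) [μB.IsAddHaarMeasure]

/-- The Cauchy-type weight `(1 + ‖h‖²) ^ (-(q + 1))` on a space of complex dimension `q` makes
`(1 + ‖h‖²)⁻¹` a beta variable with parameters `(1, q)`. -/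
lemma exists_lintegral_betaLaw {q : ℕ} (hq : Module.finrank ℝ B = 2 * q) :
    ∃ K : ℝ≥0∞, ∀ F : ℝ → ℝ≥0∞, Measurable F →
      ∫⁻ h, ENNReal.ofReal ((1 + ‖h‖ ^ 2)⁻¹ ^ (q + 1)) * F (1 + ‖h‖ ^ 2)⁻¹ ∂μB =
        K * ∫⁻ x, F x ∂betaLaw q := by
  cases q with
  | zero =>
    have : Subsingleton B := Module.finrank_zero_iff.1 hq
    refine ⟨μB univ, fun F hF => ?_⟩
    have h0 : ∀ h : B, ‖h‖ = 0 := fun h => by rw [Subsingleton.elim h 0, norm_zero]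
    simp_rw [h0]
    simp [betaLaw, lintegral_dirac' _ hF, mul_comm]
  | succ q =>
    have : Nontrivial B := Module.nontrivial_of_finrank_pos (R := ℝ) (by omega)
    obtain ⟨K, hK⟩ := exists_lintegral_fun_norm μB
    refine ⟨K * (ENNReal.ofReal (1 / 2) * ENNReal.ofReal (beta 1 (q + 1))), fun F hF => ?_⟩
    have hb : 0 < beta 1 ((q : ℝ) + 1) := beta_pos one_pos (by positivity)
    rw [hK (fun y => ENNReal.ofReal ((1 + y ^ 2)⁻¹ ^ (q + 1 + 1)) * F (1 + y ^ 2)⁻¹) (by fun_prop),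
      lintegral_betaLaw_succ q hF, lintegral_Ioo_eq]
    have e : K * (ENNReal.ofReal (1 / 2) * ENNReal.ofReal (beta 1 (q + 1))) *
        (ENNReal.ofReal (1 / beta 1 (q + 1)) * ∫⁻ y in Ioi (0 : ℝ),
          ENNReal.ofReal (2 * y / (1 + y ^ 2) ^ 2) *
            (ENNReal.ofReal ((1 - (1 + y ^ 2)⁻¹) ^ q) * F (1 + y ^ 2)⁻¹)) =
        K * (ENNReal.ofReal (1 / 2) * ∫⁻ y in Ioi (0 : ℝ),
          ENNReal.ofReal (2 * y / (1 + y ^ 2) ^ 2) *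
            (ENNReal.ofReal ((1 - (1 + y ^ 2)⁻¹) ^ q) * F (1 + y ^ 2)⁻¹)) := by
      have : ENNReal.ofReal (beta 1 (q + 1)) * ENNReal.ofReal (1 / beta 1 (q + 1)) = 1 := by
        rw [← ENNReal.ofReal_mul hb.le, mul_one_div_cancel hb.ne', ENNReal.ofReal_one]
      rw [mul_assoc, mul_assoc, ← mul_assoc (ENNReal.ofReal (beta 1 (q + 1))), this, one_mul]
    rw [e, ← lintegral_const_mul (ENNReal.ofReal (1 / 2)) (by fun_prop)]
    congr 1
    refine setLIntegral_congr_fun measurableSet_Ioi fun y hy => ?_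
    have hy' : 0 < y := hy
    have h1 : 0 ≤ 1 - (1 + y ^ 2)⁻¹ := by
      have : (1 + y ^ 2)⁻¹ ≤ 1 := inv_le_one_of_one_le₀ (by nlinarith)
      linarith
    rw [← mul_assoc, ← mul_assoc, ← mul_assoc, ← ENNReal.ofReal_mul (by positivity),
      ← ENNReal.ofReal_mul (by positivity), ← ENNReal.ofReal_mul (by positivity), hq]
    congr 2
    have h2 : 1 - (1 + y ^ 2)⁻¹ = y ^ 2 / (1 + y ^ 2) := by field_simp; ring
    have h3 : 2 * (q + 1) - 1 = 2 * q + 1 := by omega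
    have h4 : 0 < 1 + y ^ 2 := by positivity
    rw [h2, h3, div_pow, ← pow_mul, inv_pow]
    generalize 1 + y ^ 2 = s at h4
    field_simp
    ring

lemma lintegral_complex_polar {φ : ℝ → ℝ≥0∞} (hφ : Measurable φ) {ψ : ℂ → ℝ≥0∞}
    (hψ : Measurable ψ) :
    ∫⁻ a : ℂ, φ ‖a‖ * ψ (a / ‖a‖) = (∫⁻ r in Ioi (0 : ℝ), ENNReal.ofReal r * φ r) *
      ∫⁻ θ in Ioo (-Real.pi) Real.pi, ψ (Complex.exp (θ * Complex.I)) := by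
  rw [← Complex.lintegral_comp_polarCoord_symm, polarCoord_target, Measure.volume_eq_prod,
    ← Measure.prod_restrict, ← lintegral_prod_mul (by fun_prop) (by fun_prop),
    Measure.prod_restrict]
  refine setLIntegral_congr_fun (measurableSet_Ioi.prod measurableSet_Ioo) fun w hw => ?_
  have hr : 0 < w.1 := hw.1
  have h1 : Complex.polarCoord.symm w = w.1 * Complex.exp (w.2 * Complex.I) := by
    rw [Complex.polarCoord_symm_apply, Complex.exp_mul_I]
    simp
  have h2 : ‖(w.1 : ℂ) * Complex.exp (w.2 * Complex.I)‖ = w.1 := by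
    rw [norm_mul, Complex.norm_exp_ofReal_mul_I, mul_one, Complex.norm_of_nonneg hr.le]
  have h3 : (w.1 : ℂ) ≠ 0 := by exact_mod_cast hr.ne'
  rw [h1, h2, mul_div_cancel_left₀ _ h3, smul_eq_mul, mul_assoc]

lemma lintegral_Ioi_scale {k : ℝ → ℝ≥0∞} (hk : Measurable k) (m : ℕ) {κ : ℝ} (hκ : 0 < κ) :
    ∫⁻ r in Ioi (0 : ℝ), ENNReal.ofReal r * (ENNReal.ofReal (r ^ m) * k (r * κ)) =
      ENNReal.ofReal (κ⁻¹ ^ (m + 2)) * ∫⁻ s in Ioi (0 : ℝ), ENNReal.ofReal (s ^ (m + 1)) * k s := by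
  have hm : Measurable ((Ioi (0 : ℝ)).indicator fun r =>
      ENNReal.ofReal r * (ENNReal.ofReal (r ^ m) * k (r * κ))) :=
    Measurable.indicator (by fun_prop) measurableSet_Ioi
  rw [← lintegral_indicator measurableSet_Ioi, ← lintegral_indicator measurableSet_Ioi,
    lintegral_smul_pos volume
      hm (inv_pos.2 hκ),
    ← lintegral_const_mul _ (Measurable.indicator (by fun_prop) measurableSet_Ioi),
    ← lintegral_const_mul _ (by exact hm.comp (f := fun s : ℝ => κ⁻¹ • s) (by fun_prop))]
  refine lintegral_congr fun s => ?_
  rw [Module.finrank_self, pow_one, smul_eq_mul]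
  by_cases hs : 0 < s
  · have hs' : 0 < κ⁻¹ * s := by positivity
    rw [indicator_of_mem (show κ⁻¹ * s ∈ Ioi (0 : ℝ) from hs'),
      indicator_of_mem (show s ∈ Ioi (0 : ℝ) from hs)]
    have e : κ⁻¹ * s * κ = s := by field_simp
    rw [e, ← mul_assoc, ← mul_assoc, ← mul_assoc, ← ENNReal.ofReal_mul (by positivity),
      ← ENNReal.ofReal_mul (by positivity), ← ENNReal.ofReal_mul (by positivity)]
    congr 2
    ring
  · have hs' : ¬ 0 < κ⁻¹ * s := by
      rw [mul_pos_iff_of_pos_left (inv_pos.2 hκ)]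
      exact hs
    rw [indicator_of_notMem (show κ⁻¹ * s ∉ Ioi (0 : ℝ) from hs'),
      indicator_of_notMem (show s ∉ Ioi (0 : ℝ) from hs), mul_zero, mul_zero]

/-- Under a rotation invariant weight on `B × ℂ`, with `q` the complex dimension of `B`, the
ratio `a / √(‖a‖² + ‖b‖²)` is distributed as `e^{iθ} √B_{1,q}`. -/
lemma exists_lintegral_diskLaw {q : ℕ} (hq : Module.finrank ℝ B = 2 * q) {k : ℝ → ℝ≥0∞}
    (hk : Measurable k) :
    ∃ K : ℝ≥0∞, ∀ ψ : ℂ → ℝ≥0∞, Measurable ψ →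
      ∫⁻ b, ∫⁻ a : ℂ, ψ (a / (√(‖a‖ ^ 2 + ‖b‖ ^ 2) : ℂ)) * k √(‖a‖ ^ 2 + ‖b‖ ^ 2) ∂volume ∂μB =
        K * ∫⁻ x, ψ x ∂diskLaw q := by
  obtain ⟨K, hK⟩ := exists_lintegral_betaLaw μB hq
  set K₀ := ∫⁻ s in Ioi (0 : ℝ), ENNReal.ofReal (s ^ (2 * q + 1)) * k s
  refine ⟨K₀ * K * ENNReal.ofReal (2 * Real.pi), fun ψ hψ => ?_⟩
  rw [lintegral_lintegral_swap (by fun_prop)]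
  -- Scale `b = ‖a‖ h`, so that the modulus of `a / √(‖a‖² + ‖b‖²)` only depends on `h`.
  have h1 : ∀ᵐ a : ℂ, ∫⁻ b, ψ (a / (√(‖a‖ ^ 2 + ‖b‖ ^ 2) : ℂ)) * k √(‖a‖ ^ 2 + ‖b‖ ^ 2) ∂μB =
      ∫⁻ h, (ENNReal.ofReal (‖a‖ ^ (2 * q)) * k (‖a‖ * √(1 + ‖h‖ ^ 2))) *
        ψ (a / ‖a‖ * (√((1 + ‖h‖ ^ 2)⁻¹) : ℂ)) ∂μB := by
    have h0 : ∀ᵐ a : ℂ, a ≠ 0 := by simp [ae_iff]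
    filter_upwards [h0] with a ha
    have ha' : 0 < ‖a‖ := norm_pos_iff.2 ha
    rw [lintegral_smul_pos μB (by fun_prop) ha', hq, ← lintegral_const_mul _ (by fun_prop)]
    refine lintegral_congr fun h => ?_
    have e : √(‖a‖ ^ 2 + ‖‖a‖ • h‖ ^ 2) = ‖a‖ * √(1 + ‖h‖ ^ 2) := by
      rw [norm_smul, norm_norm, mul_pow, ← mul_one_add, Real.sqrt_mul (by positivity),
        Real.sqrt_sq ha'.le]
    have e2 : a / ((‖a‖ * √(1 + ‖h‖ ^ 2) : ℝ) : ℂ) = a / ‖a‖ * (√((1 + ‖h‖ ^ 2)⁻¹) : ℂ) := by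
      rw [Real.sqrt_inv]
      push_cast
      rw [div_mul_eq_div_div, div_eq_mul_inv (a / _)]
    rw [e, e2]
    ring
  rw [lintegral_congr_ae h1, lintegral_lintegral_swap (by fun_prop)]
  have h2 : ∀ h : B, ∫⁻ a : ℂ, (ENNReal.ofReal (‖a‖ ^ (2 * q)) * k (‖a‖ * √(1 + ‖h‖ ^ 2))) *
        ψ (a / ‖a‖ * (√((1 + ‖h‖ ^ 2)⁻¹) : ℂ)) =
      K₀ * (ENNReal.ofReal ((1 + ‖h‖ ^ 2)⁻¹ ^ (q + 1)) * ∫⁻ θ in Ioo (-Real.pi) Real.pi,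
          ψ (Complex.exp (θ * Complex.I) * (√((1 + ‖h‖ ^ 2)⁻¹) : ℂ))) := by
    intro h
    rw [lintegral_complex_polar
      (φ := fun r => ENNReal.ofReal (r ^ (2 * q)) * k (r * √(1 + ‖h‖ ^ 2))) (by fun_prop)
      (ψ := fun u => ψ (u * (√((1 + ‖h‖ ^ 2)⁻¹) : ℂ))) (by fun_prop),
      lintegral_Ioi_scale hk _ (by positivity)]
    have e : (√(1 + ‖h‖ ^ 2))⁻¹ ^ (2 * q + 2) = (1 + ‖h‖ ^ 2)⁻¹ ^ (q + 1) := by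
      rw [← mul_add_one, pow_mul, inv_pow, Real.sq_sqrt (by positivity)]
    rw [e]
    ring
  simp_rw [h2]
  have hΘ : Measurable fun x : ℝ => ∫⁻ θ in Ioo (-Real.pi) Real.pi,
      ψ (Complex.exp (θ * Complex.I) * (√x : ℂ)) :=
    Measurable.lintegral_prod_right' (f := fun w : ℝ × ℝ =>
      ψ (Complex.exp (w.2 * Complex.I) * (√w.1 : ℂ))) (by fun_prop)
  rw [lintegral_const_mul _ (by
    refine Measurable.mul (by fun_prop) ?_
    exact hΘ.comp (f := fun h : B => (1 + ‖h‖ ^ 2)⁻¹) (by fun_prop)), hK _ hΘ,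
    lintegral_diskLaw q hψ]
  have hpi : ENNReal.ofReal (2 * Real.pi) * (ENNReal.ofReal (2 * Real.pi))⁻¹ = 1 := by
    refine ENNReal.mul_inv_cancel ?_ ENNReal.ofReal_ne_top
    rw [Ne, ENNReal.ofReal_eq_zero, not_le]
    exact Real.two_pi_pos
  rw [mul_assoc (K₀ * K), ← mul_assoc (ENNReal.ofReal (2 * Real.pi)), hpi, one_mul, mul_assoc]

end Disk

/-! ### Integration of the factor over the sphere -/

section Sphere

variable {C B V : Type*} [NormedAddCommGroup C] [NormedSpace ℝ C] [FiniteDimensional ℝ C]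
  [MeasurableSpace C] [BorelSpace C]
  [NormedAddCommGroup B] [NormedSpace ℝ B] [FiniteDimensional ℝ B]
  [MeasurableSpace B] [BorelSpace B]
  [NormedAddCommGroup V] [NormedSpace ℝ V] [FiniteDimensional ℝ V]
  [MeasurableSpace V] [BorelSpace V] (μ : Measure V) [μ.IsAddHaarMeasure]

/-- On the unit sphere of `C ⊕ B ⊕ ℂ`, with `p` and `q` the complex dimensions of `C` and `B`,
the variable `(‖1 - a‖² + ‖c‖²) / (1 - conj a)` is distributed as `1 - X`, where `X` is sampled
from `diskLaw q` with the weight `‖1 - X‖ ^ (2 p)`. -/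
lemma exists_lintegral_sphere {p q : ℕ} (hp : Module.finrank ℝ C = 2 * p)
    (hq : Module.finrank ℝ B = 2 * q) (M : (C × B × ℂ) ≃L[ℝ] V)
    (hM : ∀ w, ‖M w‖ = √(‖w.2.2‖ ^ 2 + (‖w.1‖ ^ 2 + ‖w.2.1‖ ^ 2))) :
    ∃ K : ℝ≥0∞, ∀ f : ℂ → ℝ≥0∞, Measurable f →
      ∫⁻ x : Metric.sphere (0 : V) 1, f ((1 - conj (M.symm x).2.2)⁻¹ *
        ((‖1 - (M.symm x).2.2‖ ^ 2 + ‖(M.symm x).1‖ ^ 2 : ℝ) : ℂ)) ∂μ.toSphere =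
      K * ∫⁻ x, ENNReal.ofReal (‖1 - x‖ ^ (2 * p)) * f (1 - x) ∂diskLaw q := by
  have : Nontrivial V := M.injective.nontrivial
  obtain ⟨K₁, hK₁⟩ := exists_lintegral_toSphere μ
  set μC : Measure C := Measure.addHaar
  set μB : Measure B := Measure.addHaar
  have : (μC.prod (μB.prod (volume : Measure ℂ))).IsAddHaarMeasure :=
    Measure.prod.instIsAddHaarMeasure μC (μB.prod volume)
  obtain ⟨K₂, hK₂⟩ := exists_lintegral_comp_equiv μ (μC.prod (μB.prod volume)) M
  set g : ℝ → ℝ≥0∞ := (Iio (1 : ℝ)).indicator 1 with hg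
  have hgm : Measurable g := measurable_one.indicator measurableSet_Iio
  obtain ⟨K₃, hK₃⟩ := exists_lintegral_diskLaw μB hq (k := fun r => ∫⁻ h : C,
    ENNReal.ofReal (r ^ (2 * p)) * ENNReal.ofReal ((1 + ‖h‖ ^ 2) ^ (q + 1)) *
      g ((1 + ‖h‖ ^ 2) * r) ∂μC)
    (Measurable.lintegral_prod_right' (f := fun w : ℝ × C =>
      ENNReal.ofReal (w.1 ^ (2 * p)) * ENNReal.ofReal ((1 + ‖w.2‖ ^ 2) ^ (q + 1)) *
      g ((1 + ‖w.2‖ ^ 2) * w.1)) (by fun_prop))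
  refine ⟨K₁ * (K₂ * K₃), fun f hf => ?_⟩
  have hMs : Measurable M.symm := M.symm.continuous.measurable
  -- The extension of the integrand that is constant along rays.
  set F : V → ℝ≥0∞ := fun v => f (
    ((‖(‖v‖ : ℂ) - (M.symm v).2.2‖ ^ 2 + ‖(M.symm v).1‖ ^ 2 : ℝ) : ℂ) / ((‖v‖ : ℂ) * conj ((‖v‖ : ℂ) - (M.symm v).2.2))) with hF
  have hFm : Measurable F := by
    simp only [hF]
    fun_prop
  have h1 : ∀ x : Metric.sphere (0 : V) 1, f ((1 - conj (M.symm x).2.2)⁻¹ *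
        ((‖1 - (M.symm x).2.2‖ ^ 2 + ‖(M.symm x).1‖ ^ 2 : ℝ) : ℂ)) = F x := by
    intro x
    have hx : ‖x.1‖ = 1 := by simp
    simp only [hF]
    rw [hx, Complex.ofReal_one, one_mul, map_sub, map_one, mul_comm, div_eq_mul_inv]
  have h2 : ∀ r : ℝ, 0 < r → ∀ v, F (r • v) = F v := by
    intro r hr v
    have hrC : (r : ℂ) ≠ 0 := by exact_mod_cast hr.ne'
    have e1 : (‖r • v‖ : ℂ) - (M.symm (r • v)).2.2 = r * ((‖v‖ : ℂ) - (M.symm v).2.2) := by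
      rw [norm_smul, Real.norm_of_nonneg hr.le, map_smul]
      simp
      ring
    have e2 : ‖(M.symm (r • v)).1‖ = r * ‖(M.symm v).1‖ := by
      rw [map_smul, Prod.smul_fst, norm_smul, Real.norm_of_nonneg hr.le]
    simp only [hF]
    rw [e1, e2, norm_mul, Complex.norm_of_nonneg hr.le, mul_pow, mul_pow, ← mul_add, map_mul,
      Complex.conj_ofReal, norm_smul, Real.norm_of_nonneg hr.le]
    congr 1
    push_cast
    rw [mul_mul_mul_comm, ← pow_two, mul_div_mul_left _ _ (pow_ne_zero 2 hrC)]
  simp_rw [h1]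
  rw [hK₁ F hFm h2, hK₂ _ (by fun_prop), mul_assoc, mul_assoc, lintegral_prod _ (by fun_prop)]
  congr 2
  have h3 : ∀ c, ∫⁻ y : B × ℂ, F (M (c, y)) * g ‖M (c, y)‖ ∂(μB.prod volume) =
      ∫⁻ b, ∫⁻ a, F (M (c, b, a)) * g ‖M (c, b, a)‖ ∂volume ∂μB := fun c =>
    lintegral_prod _ (by
      have : Measurable M := M.continuous.measurable
      fun_prop)
  simp_rw [h3]
  simp only [hF, hM, ContinuousLinearEquiv.symm_apply_apply]
  rw [lintegral_ratio_eq μC μB hp hq hf hgm]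
  exact hK₃ (fun x => ENNReal.ofReal (‖1 - x‖ ^ (2 * p)) * f (1 - x)) (by fun_prop)

end Sphere

end CondHaar

namespace CondHaar

open Matrix Polynomial

/-! ### Decomposition along the fixed space -/

section Decomposition

variable {n : ℕ}

/-- Extension by `0` to the coordinates `i < j`. -/
def zeroExtend (j : Fin n) (v : EuclideanSpace ℂ (Set.Ici j)) : EuclideanSpace ℂ (Fin n) :=
  WithLp.toLp 2 fun i => if h : j ≤ i then v ⟨i, h⟩ else 0

/-- Restriction to the coordinates `i ≥ j`. -/
def coordRestrict (j : Fin n) :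
    EuclideanSpace ℂ (Fin n) →ₗ[ℂ] EuclideanSpace ℂ (Set.Ici j) where
  toFun y := WithLp.toLp 2 fun i => y i.1
  map_add' _ _ := rfl
  map_smul' _ _ := rfl

lemma coordRestrict_apply (j : Fin n) (y : EuclideanSpace ℂ (Fin n)) (i : Set.Ici j) :
    coordRestrict j y i = y i.1 := rfl

lemma zeroExtend_coordRestrict {j : Fin n} {y : EuclideanSpace ℂ (Fin n)}
    (hy : ∀ i < j, y i = 0) : zeroExtend j (coordRestrict j y) = y := by
  ext i
  simp only [zeroExtend, coordRestrict_apply]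
  split_ifs with h
  · rfl
  · exact (hy i (not_le.1 h)).symm

lemma coordRestrict_zeroExtend {j : Fin n} (v : EuclideanSpace ℂ (Set.Ici j)) :
    coordRestrict j (zeroExtend j v) = v := by
  ext i
  have h : j ≤ i.1 := i.2
  simp [zeroExtend, coordRestrict_apply, h]

lemma norm_coordRestrict {j : Fin n} {y : EuclideanSpace ℂ (Fin n)}
    (hy : ∀ i < j, y i = 0) : ‖coordRestrict j y‖ = ‖y‖ := by
  rw [EuclideanSpace.norm_eq, EuclideanSpace.norm_eq]
  congr 1
  rw [← Finset.sum_subset (Finset.subset_univ (Finset.Ici j)) (by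
      intro i _ hi
      have : i < j := by simpa using hi
      simp [hy i this]),
    Finset.sum_subtype (Finset.Ici j) (p := fun i => i ∈ Set.Ici j) (by simp)
      (fun i => ‖y i‖ ^ 2)]
  rfl

/-- The vectors of `K` whose coordinates `i ≤ j` vanish. -/
def tailSubspace (K : Submodule ℂ (EuclideanSpace ℂ (Fin n))) (j : Fin n) :
    Submodule ℂ (EuclideanSpace ℂ (Fin n)) where
  carrier := {y | y ∈ K ∧ ∀ i ≤ j, y i = 0}
  add_mem' hx hy := ⟨K.add_mem hx.1 hy.1, fun i hi => by simp [hx.2 i hi, hy.2 i hi]⟩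
  zero_mem' := ⟨K.zero_mem, fun _ _ => rfl⟩
  smul_mem' c y hy := ⟨K.smul_mem c hy.1, fun i hi => by simp [hy.2 i hi]⟩

variable (K : Submodule ℂ (EuclideanSpace ℂ (Fin n))) (j : Fin n)

/-- The sum `c + b + a e_j`. -/
def assembleVector :
    (tailSubspace K j × Kᗮ × ℂ) →ₗ[ℂ] EuclideanSpace ℂ (Fin n) :=
  (tailSubspace K j).subtype ∘ₗ LinearMap.fst ℂ _ _ +
    (Kᗮ.subtype ∘ₗ LinearMap.fst ℂ _ _ +
      (LinearMap.toSpanSingleton ℂ _ (EuclideanSpace.single j (1 : ℂ))) ∘ₗ LinearMap.snd ℂ _ _) ∘ₗ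
        LinearMap.snd ℂ _ _

lemma assembleVector_apply (w : tailSubspace K j × Kᗮ × ℂ) :
    assembleVector K j w = w.1.1 + (w.2.1.1 + w.2.2 • EuclideanSpace.single j (1 : ℂ)) := rfl

variable {K j}

lemma orthogonal_apply_eq_zero {i : Fin n} (hi : EuclideanSpace.single i (1 : ℂ) ∈ K)
    {b : EuclideanSpace ℂ (Fin n)} (hb : b ∈ Kᗮ) : b i = 0 := by
  have h := hb _ hi
  simpa [EuclideanSpace.inner_single_left] using h

lemma assembleVector_apply_of_lt (hK : ∀ i ≤ j, EuclideanSpace.single i (1 : ℂ) ∈ K)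
    (w : tailSubspace K j × Kᗮ × ℂ) (i : Fin n) (hi : i < j) : assembleVector K j w i = 0 := by
  have h1 := w.1.2.2 i hi.le
  have h2 := orthogonal_apply_eq_zero (hK i hi.le) w.2.1.2
  simp [assembleVector_apply, h1, h2, hi.ne]

lemma assembleVector_apply_self (hK : ∀ i ≤ j, EuclideanSpace.single i (1 : ℂ) ∈ K)
    (w : tailSubspace K j × Kᗮ × ℂ) : assembleVector K j w j = w.2.2 := by
  have h1 := w.1.2.2 j le_rfl
  have h2 := orthogonal_apply_eq_zero (hK j le_rfl) w.2.1.2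
  simp [assembleVector_apply, h1, h2]

lemma norm_sq_tail_add_single (c : tailSubspace K j) (a : ℂ) :
    ‖c.1 + a • EuclideanSpace.single j (1 : ℂ)‖ ^ 2 = ‖a‖ ^ 2 + ‖c‖ ^ 2 := by
  have h : inner ℂ c.1 (a • EuclideanSpace.single j (1 : ℂ)) = 0 := by
    rw [inner_smul_right, EuclideanSpace.inner_single_right, c.2.2 j le_rfl]
    simp
  have := norm_add_sq_eq_norm_sq_add_norm_sq_of_inner_eq_zero _ _ h
  rw [← sq, ← sq, ← sq] at this
  rw [this, norm_smul]
  simp [add_comm]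

lemma tail_add_single_mem (hK : ∀ i ≤ j, EuclideanSpace.single i (1 : ℂ) ∈ K)
    (c : tailSubspace K j) (a : ℂ) : c.1 + a • EuclideanSpace.single j (1 : ℂ) ∈ K :=
  K.add_mem c.2.1 (K.smul_mem a (hK j le_rfl))

lemma norm_assembleVector (hK : ∀ i ≤ j, EuclideanSpace.single i (1 : ℂ) ∈ K)
    (w : tailSubspace K j × Kᗮ × ℂ) :
    ‖assembleVector K j w‖ = √(‖w.2.2‖ ^ 2 + (‖w.1‖ ^ 2 + ‖w.2.1‖ ^ 2)) := by
  have h : inner ℂ (w.1.1 + w.2.2 • EuclideanSpace.single j (1 : ℂ)) w.2.1.1 = 0 :=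
    w.2.1.2 _ (tail_add_single_mem hK w.1 w.2.2)
  have e : assembleVector K j w =
      (w.1.1 + w.2.2 • EuclideanSpace.single j (1 : ℂ)) + w.2.1.1 := by
    rw [assembleVector_apply]
    abel
  have := norm_add_sq_eq_norm_sq_add_norm_sq_of_inner_eq_zero _ _ h
  rw [← e, ← sq, ← sq, ← sq, norm_sq_tail_add_single] at this
  rw [← Real.sqrt_sq (norm_nonneg _), this, add_assoc]
  rfl

/-- If `K` contains `e_i` for `i ≤ j`, then every vector supported on the coordinates `i ≥ j` is
uniquely `c + b + a e_j` with `c ∈ K` supported on the coordinates `i > j` and `b ∈ Kᗮ`. -/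
lemma bijective_assembleVector (hK : ∀ i ≤ j, EuclideanSpace.single i (1 : ℂ) ∈ K) :
    Function.Bijective (coordRestrict j ∘ₗ assembleVector K j) := by
  constructor
  · rw [← LinearMap.ker_eq_bot, LinearMap.ker_eq_bot']
    intro w hw
    have h : ‖assembleVector K j w‖ = 0 := by
      rw [← norm_coordRestrict (assembleVector_apply_of_lt hK w)]
      exact norm_eq_zero.2 hw
    rw [norm_assembleVector hK, Real.sqrt_eq_zero (by positivity)] at h
    have h1 := sq_nonneg ‖w.2.2‖
    have h2 := sq_nonneg ‖w.1‖
    have h3 := sq_nonneg ‖w.2.1‖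
    refine Prod.ext (norm_eq_zero.1 (pow_eq_zero_iff two_ne_zero |>.1 ?_)) (Prod.ext
      (norm_eq_zero.1 (pow_eq_zero_iff two_ne_zero |>.1 ?_))
      (norm_eq_zero.1 (pow_eq_zero_iff two_ne_zero |>.1 ?_)))
    all_goals linarith
  · intro v
    obtain ⟨k, hk, b, hb, hkb⟩ := K.exists_add_mem_mem_orthogonal (zeroExtend j v)
    have hkj : ∀ i < j, k i = 0 := by
      intro i hi
      have h1 : zeroExtend j v i = 0 := by simp [zeroExtend, not_le.2 hi]
      have h2 := orthogonal_apply_eq_zero (hK i hi.le) hb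
      rw [hkb] at h1
      simpa [h2] using h1
    refine ⟨(⟨k - k j • EuclideanSpace.single j (1 : ℂ),
      K.sub_mem hk (K.smul_mem _ (hK j le_rfl)), fun i hi => ?_⟩, ⟨b, hb⟩, k j), ?_⟩
    · rcases hi.lt_or_eq with h | rfl
      · simp [hkj i h, h.ne]
      · simp
    · rw [LinearMap.comp_apply, assembleVector_apply]
      have : (k - k j • EuclideanSpace.single j (1 : ℂ)) +
          (b + k j • EuclideanSpace.single j (1 : ℂ)) = zeroExtend j v := by
        rw [hkb]
        abel
      simp only [this]
      exact coordRestrict_zeroExtend v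

end Decomposition

/-! ### The law of the factor of a uniform reflection -/

section FactorLaw

variable {n : ℕ}

instance isProbabilityMeasure_uniformSphere (j : Fin n) :
    IsProbabilityMeasure (uniformSphere j) := by
  constructor
  have : Nonempty (Set.Ici j) := ⟨⟨j, Set.mem_Ici.2 le_rfl⟩⟩
  have h0 : (volume : Measure (EuclideanSpace ℂ (Set.Ici j))).toSphere Set.univ ≠ 0 := by
    rw [Ne, Measure.measure_univ_eq_zero]
    exact Measure.toSphere_ne_zero _
  rw [uniformSphere, Measure.smul_apply, smul_eq_mul,
    ENNReal.inv_mul_cancel h0 (measure_ne_top _ _)]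

/-- The law of the factor contributed by a uniform reflection, up to normalization. -/
lemma exists_lintegral_uniformSphere {j : Fin n} {p q : ℕ} (hn : j + p + q + 1 = n)
    {K : Submodule ℂ (EuclideanSpace ℂ (Fin n))}
    (hK : ∀ i ≤ j, EuclideanSpace.single i (1 : ℂ) ∈ K) (hdim : Module.finrank ℂ K = j + p + 1) :
    ∃ A : ℝ≥0∞, ∀ f : ℂ → ℝ≥0∞, Measurable f →
      ∫⁻ x : CSphere j, f ((1 - conj (extend x j))⁻¹ *
        (‖K.starProjection (WithLp.toLp 2 (extend x - Pi.single j 1))‖ ^ 2 : ℝ))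
          ∂uniformSphere j =
      A * ∫⁻ y, ENNReal.ofReal (‖1 - y‖ ^ (2 * p)) * f (1 - y) ∂diskLaw q := by
  set M₀ := LinearEquiv.ofBijective _ (bijective_assembleVector hK) with hM₀
  have hV : Module.finrank ℂ (EuclideanSpace ℂ (Set.Ici j)) = n - j := by
    rw [finrank_euclideanSpace, ← Set.toFinset_card, Set.toFinset_Ici, Fin.card_Ici]
  have hq : Module.finrank ℂ Kᗮ = q := by
    have := K.finrank_add_finrank_orthogonal
    rw [hdim, finrank_euclideanSpace_fin] at this
    omega
  have hp : Module.finrank ℂ (tailSubspace K j) = p := by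
    have := M₀.finrank_eq
    rw [Module.finrank_prod, Module.finrank_prod, hV, hq, Module.finrank_self] at this
    omega
  set M : (tailSubspace K j × Kᗮ × ℂ) ≃L[ℝ] EuclideanSpace ℂ (Set.Ici j) :=
    (M₀.restrictScalars ℝ).toContinuousLinearEquiv with hM
  have hMapp : ∀ w, M w = coordRestrict j (assembleVector K j w) := fun w => rfl
  obtain ⟨A, hA⟩ := exists_lintegral_sphere (volume : Measure (EuclideanSpace ℂ (Set.Ici j)))
    (p := p) (q := q) (by rw [finrank_real_of_complex, hp]) (by rw [finrank_real_of_complex, hq]) M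
    (fun w => by
      rw [hMapp, norm_coordRestrict (assembleVector_apply_of_lt hK w), norm_assembleVector hK])
  refine ⟨((volume : Measure (EuclideanSpace ℂ (Set.Ici j))).toSphere Set.univ)⁻¹ * A,
    fun f hf => ?_⟩
  rw [uniformSphere, lintegral_smul_measure, smul_eq_mul, mul_assoc, ← hA f hf]
  congr 1
  refine lintegral_congr fun x => ?_
  set w := M.symm x.1 with hw
  have hx : WithLp.toLp 2 (extend x) = assembleVector K j w := by
    rw [← zeroExtend_coordRestrict (assembleVector_apply_of_lt hK w), ← hMapp, hw,
      ContinuousLinearEquiv.apply_symm_apply]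
    rfl
  have hxj : extend x j = w.2.2 := by
    rw [← assembleVector_apply_self hK w, ← hx]
  have hproj : K.starProjection (WithLp.toLp 2 (extend x - Pi.single j 1)) =
      w.1.1 + (w.2.2 - 1) • EuclideanSpace.single j (1 : ℂ) := by
    have e : WithLp.toLp 2 (extend x - Pi.single j 1) =
        (w.1.1 + (w.2.2 - 1) • EuclideanSpace.single j (1 : ℂ)) + w.2.1.1 := by
      rw [WithLp.toLp_sub, hx, assembleVector_apply, sub_smul, one_smul]
      have : WithLp.toLp 2 (Pi.single j (1 : ℂ)) = EuclideanSpace.single j (1 : ℂ) := rfl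
      rw [this]
      abel
    rw [e, map_add, Submodule.starProjection_eq_self_iff.2 (tail_add_single_mem hK _ _),
      (Submodule.starProjection_apply_eq_zero_iff K).2 w.2.1.2, add_zero]
  rw [hproj, norm_sq_tail_add_single, hxj, norm_sub_rev]

/-- The factor contributed by a uniform reflection is distributed as `1 - X`, with `X` of law
`factorLaw p q`. The normalization is forced: taking `f = 1` identifies the constant of
`exists_lintegral_uniformSphere` with the inverse of the total weight. -/
lemma lintegral_uniformSphere_eq {j : Fin n} {p q : ℕ} (hn : j + p + q + 1 = n)
    {K : Submodule ℂ (EuclideanSpace ℂ (Fin n))}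
    (hK : ∀ i ≤ j, EuclideanSpace.single i (1 : ℂ) ∈ K) (hdim : Module.finrank ℂ K = j + p + 1)
    {f : ℂ → ℝ≥0∞} (hf : Measurable f) :
    ∫⁻ x : CSphere j, f ((1 - conj (extend x j))⁻¹ *
        (‖K.starProjection (WithLp.toLp 2 (extend x - Pi.single j 1))‖ ^ 2 : ℝ))
          ∂uniformSphere j = ∫⁻ y, f (1 - y) ∂factorLaw p q := by
  obtain ⟨A, hA⟩ := exists_lintegral_uniformSphere hn hK hdim
  have h1 := hA (fun _ => 1) measurable_const
  simp only [mul_one, lintegral_one, measure_univ] at h1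
  rw [factorLaw, sampling, lintegral_smul_measure, smul_eq_mul, hA f hf,
    lintegral_withDensity_eq_lintegral_mul _ (by fun_prop) (by fun_prop),
    ENNReal.eq_inv_of_mul_eq_one_left h1.symm]
  rfl

instance isProbabilityMeasure_factorLaw (p q : ℕ) : IsProbabilityMeasure (factorLaw p q) := by
  -- Apply the previous lemma in dimension `p + q + 1`, with `K` a coordinate subspace.
  have hle : p + 1 ≤ p + q + 1 := by omega
  set e : Fin (p + 1) → EuclideanSpace ℂ (Fin (p + q + 1)) :=
    fun i => EuclideanSpace.single (i.castLE hle) (1 : ℂ) with he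
  have hli : LinearIndependent ℂ e := by
    have h := (EuclideanSpace.basisFun (Fin (p + q + 1)) ℂ).orthonormal.comp _
      (Fin.castLE_injective hle) |>.linearIndependent
    simpa [he, Function.comp_def] using h
  have h := lintegral_uniformSphere_eq (j := (0 : Fin (p + q + 1))) (p := p) (q := q) (by simp)
    (K := Submodule.span ℂ (Set.range e))
    (fun i hi => by
      rw [Fin.le_zero_iff.1 hi]
      exact Submodule.subset_span ⟨0, rfl⟩)
    (by rw [finrank_span_eq_card hli]; simp) (f := fun _ => 1) measurable_const
  constructor
  simpa using h.symm

/-- The law of the leading coefficient after multiplication by a uniform reflection, given the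
other factor `u`. -/
lemma lintegral_reflection_mul {u : Matrix (Fin n) (Fin n) ℂ}
    (hu : u ∈ unitaryGroup (Fin n) ℂ) {j : Fin n}
    (hfix : ∀ i ≤ j, u *ᵥ Pi.single i 1 = Pi.single i 1) {p q : ℕ} (hn : j + p + q + 1 = n)
    (hd : X ^ (j + p + 1) ∣ (u - 1).charpoly) {f : ℂ → ℝ≥0∞} (hf : Measurable f) :
    ∫⁻ x : CSphere j, f ((reflectionMatrix j (extend x) * u - 1).charpoly.coeff (j + p))
        ∂uniformSphere j =
      ∫⁻ y, f ((u - 1).charpoly.coeff (j + p + 1) * (1 - y)) ∂factorLaw p q := by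
  have h1 : ∀ x : CSphere j, (reflectionMatrix j (extend x) * u - 1).charpoly.coeff (j + p) =
      (u - 1).charpoly.coeff (j + p + 1) * ((1 - conj (extend x j))⁻¹ *
        (‖(fixedSpace u).starProjection (WithLp.toLp 2 (extend x - Pi.single j 1))‖ ^ 2 : ℝ)) :=
    fun x => (charpoly_reflectionMatrix_mul hu hd j (extend x)).2
  simp_rw [h1]
  set D := (u - 1).charpoly.coeff (j + p + 1) with hD
  by_cases hD0 : D = 0
  · -- Here the fixed space may be too large, but the argument of `f` is `0` on both sides.
    simp [hD0]
  · have hdim : Module.finrank ℂ (fixedSpace u) = j + p + 1 := by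
      rw [finrank_fixedSpace hu]
      refine le_antisymm (natTrailingDegree_le_of_ne_zero hD0) ?_
      refine le_natTrailingDegree (charpoly_monic _).ne_zero fun m hm => X_pow_dvd_iff.1 hd m hm
    exact lintegral_uniformSphere_eq hn (fun i hi => mem_fixedSpace.2 (hfix i hi)) hdim
      (f := fun z => f (D * z)) (by fun_prop)

end FactorLaw

/-! ### Products of reflections -/

section Product

variable {n : ℕ}

lemma reflectionMatrix_mulVec_single {k : Fin n} {v : Fin n → ℂ} (hv : ∀ i < k, v i = 0)
    {i : Fin n} (hi : i < k) : reflectionMatrix k v *ᵥ Pi.single i 1 = Pi.single i 1 := by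
  rw [reflectionMatrix, sub_mulVec, one_mulVec, smul_mulVec, vecMulVec_mulVec]
  simp [hv i hi, hi.ne]

lemma extend_of_lt {k : Fin n} (x : CSphere k) {i : Fin n} (hi : i < k) : extend x i = 0 := by
  simp [extend, not_le.2 hi]

/-- A product of `q` of the reflections, with consecutive indices starting from `j`, fixes the
first `j` basis vectors, and has `1` as an eigenvalue of multiplicity at least `n - q`. -/
lemma prod_reflection_properties {q : ℕ} {j d : ℕ} (hqd : q + d = n) {κ : Fin q → Fin n}
    (hκ : ∀ i, (κ i : ℕ) = j + i) (x : ∀ i, CSphere (κ i)) :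
    (∀ i : Fin n, i < j → ((List.ofFn fun i => reflection (x i)).prod :
        Matrix (Fin n) (Fin n) ℂ) *ᵥ Pi.single i 1 = Pi.single i 1) ∧
      X ^ d ∣ (((List.ofFn fun i => reflection (x i)).prod :
        unitaryGroup (Fin n) ℂ) - 1 : Matrix (Fin n) (Fin n) ℂ).charpoly := by
  induction q generalizing j d with
  | zero =>
    have hd : d = n := by omega
    simp only [List.ofFn_zero, List.prod_nil, OneMemClass.coe_one, one_mulVec, sub_self,
      Matrix.charpoly_zero, Fintype.card_fin, hd, dvd_refl, implies_true, and_self]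
  | succ q ih =>
    obtain ⟨h1, h2⟩ := ih (j := j + 1) (d := d + 1) (by omega) (κ := fun i => κ i.succ)
      (fun i => by rw [hκ]; simp; omega) (fun i => x i.succ)
    rw [List.ofFn_succ, List.prod_cons]
    constructor
    · intro i hi
      have hi' : i < κ 0 := by
        rw [Fin.lt_def, hκ]
        simpa using hi
      rw [Submonoid.coe_mul, ← mulVec_mulVec, h1 i (by omega)]
      exact reflectionMatrix_mulVec_single (fun _ h => extend_of_lt (x 0) h) hi'
    · exact (charpoly_reflectionMatrix_mul (SetLike.coe_mem _) h2 (κ 0) (extend (x 0))).1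

end Product

/-! ### Measurability on the unitary group -/

section Measurability

variable {n : ℕ}

lemma isInducing_entries : Topology.IsInducing
    fun u : unitaryGroup (Fin n) ℂ => Matrix.of.symm (u : Matrix (Fin n) (Fin n) ℂ) :=
  ⟨rfl⟩

instance : SecondCountableTopology (unitaryGroup (Fin n) ℂ) :=
  isInducing_entries.secondCountableTopology

lemma measurable_unitaryGroup {α : Type*} [MeasurableSpace α] {F : α → unitaryGroup (Fin n) ℂ}
    (hF : ∀ i j, Measurable fun x => (F x : Matrix (Fin n) (Fin n) ℂ) i j) : Measurable F := by
  have e : instMeasurableSpaceUnitaryGroup n = MeasurableSpace.comap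
      (fun u : unitaryGroup (Fin n) ℂ => Matrix.of.symm (u : Matrix (Fin n) (Fin n) ℂ))
      MeasurableSpace.pi := by
    rw [BorelSpace.measurable_eq (α := Fin n → Fin n → ℂ), ← borel_comap]
    exact congrArg _ isInducing_entries.eq_induced
  rw [e, measurable_comap_iff]
  exact measurable_pi_iff.2 fun i => measurable_pi_iff.2 fun j => hF i j

lemma measurable_extend {k : Fin n} (i : Fin n) :
    Measurable fun x : CSphere k => extend x i := by
  unfold extend
  split_ifs
  · fun_prop
  · fun_prop

lemma measurable_reflection (k : Fin n) : Measurable (reflection (k := k)) := by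
  refine measurable_unitaryGroup fun i j => ?_
  have h := measurable_extend (k := k)
  simp only [reflection, reflectionMatrix, Matrix.sub_apply, Matrix.smul_apply, vecMulVec_apply,
    Pi.sub_apply, Pi.star_apply, smul_eq_mul]
  have hc : ∀ z : ℂ, star z = conj z := fun _ => rfl
  simp only [hc]
  fun_prop

lemma continuous_charpoly_coeff (d : ℕ) :
    Continuous fun u : unitaryGroup (Fin n) ℂ =>
      ((u : Matrix (Fin n) (Fin n) ℂ) - 1).charpoly.coeff d := by
  have h : ∀ N : Matrix (Fin n) (Fin n) ℂ, N.charpoly.coeff d =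
      MvPolynomial.eval (fun ij : Fin n × Fin n => N ij.1 ij.2)
        ((charpoly.univ ℂ (Fin n)).coeff d) := fun N =>
    (charpoly.univ_coeff_eval₂Hom (Fin n) (RingHom.id ℂ) (fun ij => N ij.1 ij.2) d).symm
  simp_rw [h]
  refine (MvPolynomial.continuous_eval _).comp (continuous_pi fun ij => ?_)
  exact (Continuous.matrix_elem continuous_subtype_val _ _).sub continuous_const

lemma measurable_list_ofFn_prod (q : ℕ) :
    Measurable fun r : Fin q → unitaryGroup (Fin n) ℂ => (List.ofFn r).prod := by
  induction q with
  | zero => simp only [List.ofFn_zero, List.prod_nil, measurable_const]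
  | succ q ih =>
    simp only [List.ofFn_succ, List.prod_cons]
    exact (measurable_pi_apply 0).mul
      (ih.comp (measurable_pi_lambda _ fun i => measurable_pi_apply i.succ))

end Measurability

/-! ### Splitting off a factor of a product measure -/

section Fubini

lemma pi_eq_map_cons {q : ℕ} {α : Fin (q + 1) → Type*} [∀ i, MeasurableSpace (α i)]
    (μ : ∀ i, Measure (α i)) [∀ i, SigmaFinite (μ i)] :
    Measurable (fun y : α 0 × (∀ i : Fin q, α i.succ) => (Fin.cons y.1 y.2 : ∀ i, α i)) ∧
    Measure.pi μ = ((μ 0).prod (Measure.pi fun i : Fin q => μ i.succ)).map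
      fun y => (Fin.cons y.1 y.2 : ∀ i, α i) := by
  have hm : Measurable (fun y : α 0 × (∀ i : Fin q, α i.succ) =>
      (Fin.cons y.1 y.2 : ∀ i, α i)) := by
    refine measurable_pi_iff.2 fun i => ?_
    cases i using Fin.cases with
    | zero => exact measurable_fst
    | succ i => exact (measurable_pi_apply i).comp measurable_snd
  refine ⟨hm, Measure.pi_eq fun s hs => ?_⟩
  have h : (fun y : α 0 × (∀ i : Fin q, α i.succ) => (Fin.cons y.1 y.2 : ∀ i, α i)) ⁻¹'
      (Set.univ.pi s) = s 0 ×ˢ (Set.univ.pi fun i : Fin q => s i.succ) := by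
    ext y
    simp [Fin.forall_fin_succ]
  rw [Measure.map_apply hm (MeasurableSet.univ_pi hs), h, Measure.prod_prod, Measure.pi_pi,
    Fin.prod_univ_succ]

lemma pi_eq_map_snoc {q : ℕ} {α : Type*} [MeasurableSpace α]
    (μ : Fin (q + 1) → Measure α) [∀ i, SigmaFinite (μ i)] :
    Measurable (fun y : (Fin q → α) × α => (Fin.snoc y.1 y.2 : Fin (q + 1) → α)) ∧
    Measure.pi μ = ((Measure.pi fun i : Fin q => μ i.castSucc).prod (μ (Fin.last q))).map
      fun y => (Fin.snoc y.1 y.2 : Fin (q + 1) → α) := by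
  have hm : Measurable (fun y : (Fin q → α) × α => (Fin.snoc y.1 y.2 : Fin (q + 1) → α)) := by
    refine measurable_pi_iff.2 fun i => ?_
    cases i using Fin.lastCases with
    | last => simpa using measurable_snd
    | cast i => simpa [Function.comp_def] using (measurable_pi_apply i).comp measurable_fst
  refine ⟨hm, Measure.pi_eq fun s hs => ?_⟩
  have h : (fun y : (Fin q → α) × α => (Fin.snoc y.1 y.2 : Fin (q + 1) → α)) ⁻¹'
      (Set.univ.pi s) = (Set.univ.pi fun i => s i.castSucc) ×ˢ s (Fin.last q) := by
    ext y
    simp [Fin.forall_fin_succ']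
  rw [Measure.map_apply hm (MeasurableSet.univ_pi hs), h, Measure.prod_prod, Measure.pi_pi,
    Fin.prod_univ_castSucc]

end Fubini

/-! ### The law of the product -/

section Law

variable {n : ℕ}

/-- The law of the leading coefficient at `1` of the characteristic polynomial of a product of
`q` independent reflections with consecutive indices starting from `j`. -/
lemma lintegral_prod_reflection {q j p : ℕ} (hn : j + p + q = n) {κ : Fin q → Fin n}
    (hκ : ∀ i, (κ i : ℕ) = j + i) {f : ℂ → ℝ≥0∞} (hf : Measurable f) :
    ∫⁻ x : ∀ i, CSphere (κ i), f ((((List.ofFn fun i => reflection (x i)).prod :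
        unitaryGroup (Fin n) ℂ) - 1 : Matrix (Fin n) (Fin n) ℂ).charpoly.coeff (j + p))
          ∂Measure.pi (fun i => uniformSphere (κ i)) =
      ∫⁻ Y : Fin q → ℂ, f (∏ ℓ, (1 - Y ℓ)) ∂Measure.pi fun ℓ : Fin q => factorLaw p ℓ := by
  induction q generalizing j f with
  | zero =>
    have hd : j + p = n := by omega
    simp [Matrix.charpoly_zero, hd]
  | succ q ih =>
    have hκ' : ∀ i : Fin q, (κ i.succ : ℕ) = j + 1 + i := fun i => by rw [hκ]; simp; omega
    have hκ0 : (κ 0 : ℕ) = j := by rw [hκ]; simp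
    obtain ⟨hm, hpi⟩ := pi_eq_map_cons (fun i => uniformSphere (κ i))
    obtain ⟨hm', hpi'⟩ := pi_eq_map_snoc (fun ℓ : Fin (q + 1) => factorLaw p ℓ)
    have hprod : ∀ m (κ : Fin m → Fin n), Measurable fun x : (∀ i, CSphere (κ i)) =>
        (List.ofFn fun i => reflection (x i)).prod := fun m κ =>
      (measurable_list_ofFn_prod m).comp
        (measurable_pi_lambda _ fun i => (measurable_reflection (κ i)).comp (measurable_pi_apply i))
    have hL : ∀ m (κ : Fin m → Fin n) d, Measurable fun x : (∀ i, CSphere (κ i)) =>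
        (((List.ofFn fun i => reflection (x i)).prod :
          unitaryGroup (Fin n) ℂ) - 1 : Matrix (Fin n) (Fin n) ℂ).charpoly.coeff d := fun m κ d =>
      (continuous_charpoly_coeff d).measurable.comp (hprod m κ)
    rw [hpi, hpi', lintegral_map (by exact hf.comp (hL _ _ _)) hm,
      lintegral_map (by fun_prop) hm',
      lintegral_prod_symm _ (by exact ((hf.comp (hL _ _ _)).comp hm).aemeasurable),
      lintegral_prod_symm _ (by
        exact (Measurable.comp (g := fun Y : Fin (q + 1) → ℂ => f (∏ ℓ, (1 - Y ℓ)))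
          (by fun_prop) hm').aemeasurable)]
    -- Integrate over the leftmost reflection, the others being fixed.
    have step : ∀ y : (∀ i : Fin q, CSphere (κ i.succ)), ∫⁻ x : CSphere (κ 0),
        f ((((List.ofFn fun i => reflection ((Fin.cons x y : ∀ i, CSphere (κ i)) i)).prod :
          unitaryGroup (Fin n) ℂ) - 1 : Matrix (Fin n) (Fin n) ℂ).charpoly.coeff (j + p))
            ∂uniformSphere (κ 0) =
        ∫⁻ z, f ((((List.ofFn fun i => reflection (y i)).prod :
          unitaryGroup (Fin n) ℂ) - 1 : Matrix (Fin n) (Fin n) ℂ).charpoly.coeff (j + 1 + p) *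
            (1 - z)) ∂factorLaw p q := by
      intro y
      obtain ⟨h1, h2⟩ := prod_reflection_properties (d := j + 1 + p) (by omega) hκ' y
      have hj : j + 1 + p = (κ 0 : ℕ) + p + 1 := by omega
      rw [hj] at h2 ⊢
      rw [← lintegral_reflection_mul (SetLike.coe_mem _) (j := κ 0)
        (fun i hi => h1 i (by rw [Fin.le_def] at hi; omega)) (q := q) (by omega) h2 hf, hκ0]
      refine lintegral_congr fun x => ?_
      rw [List.ofFn_succ, List.prod_cons]
      rfl
    refine (lintegral_congr step).trans ?_
    rw [lintegral_lintegral_swap (by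
      have := hL q (fun i => κ i.succ) (j + 1 + p)
      exact (hf.comp ((this.comp measurable_fst).mul
        (measurable_const.sub measurable_snd))).aemeasurable)]
    refine lintegral_congr fun z => ?_
    rw [ih (j := j + 1) (by omega) hκ' (f := fun w => f (w * (1 - z))) (by fun_prop)]
    refine lintegral_congr fun Y => ?_
    rw [Fin.prod_univ_castSucc]
    simp

end Law

end CondHaar

end

theorem corollary4p1 (n p : ℕ) (hp : p ≤ n) :
    IdentDistrib
      (fun u : Matrix.unitaryGroup (Fin n) ℂ => CondHaar.charpolyDeriv p u / (p.factorial : ℂ))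
      (fun X : Fin (n - p) → ℂ => ∏ ℓ, (1 - X ℓ))
      (CondHaar.condHaar n p)
      (Measure.pi fun ℓ : Fin (n - p) => CondHaar.factorLaw p ℓ) := by
  have hZ : Measurable fun u : Matrix.unitaryGroup (Fin n) ℂ =>
      CondHaar.charpolyDeriv p u / (p.factorial : ℂ) := by
    simp_rw [CondHaar.charpolyDeriv_div_factorial]
    exact (CondHaar.continuous_charpoly_coeff p).measurable
  have hP : Measurable fun X : Fin (n - p) → ℂ => ∏ ℓ, (1 - X ℓ) := by fun_prop
  refine ⟨hZ.aemeasurable, hP.aemeasurable, ?_⟩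
  set κ : Fin (n - p) → Fin n := fun k => k.castLE (Nat.sub_le n p)
  have hpr : ∀ k, IsProbabilityMeasure
      ((CondHaar.uniformSphere (κ k)).map (CondHaar.reflection (k := κ k))) := fun k =>
    Measure.isProbabilityMeasure_map (CondHaar.measurable_reflection (κ k)).aemeasurable
  have h1 : (Measure.pi fun k => CondHaar.reflectionLaw (κ k)) =
      (Measure.pi fun k => CondHaar.uniformSphere (κ k)).map
        fun x k => CondHaar.reflection (x k) :=
    (Measure.pi_map_pi fun k => (CondHaar.measurable_reflection (κ k)).aemeasurable).symm
  refine Measure.ext_of_lintegral _ fun f hf => ?_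
  rw [lintegral_map hf hZ, lintegral_map hf hP, CondHaar.condHaar, h1,
    lintegral_map (by exact hf.comp hZ) (CondHaar.measurable_list_ofFn_prod _),
    lintegral_map (by exact (hf.comp hZ).comp (CondHaar.measurable_list_ofFn_prod _))
      (by exact measurable_pi_lambda _ fun k =>
        (CondHaar.measurable_reflection (κ k)).comp (measurable_pi_apply k)),
    ← CondHaar.lintegral_prod_reflection (j := 0) (by omega) (κ := κ)
      (fun i => by simp [κ]) hf]
  refine lintegral_congr fun x => ?_
  simp only [CondHaar.charpolyDeriv_div_factorial, zero_add]
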